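/- All graphs are finite; loops and multiple edges are allowed. A \emph{relative plane graph} is a plane graph $G$ with a distinguished set $H\subseteq E(G)$ of \emph{0-edges}; the other edges are called regular. A \emph{ribbon graph} $R$ is a surface with boundary, orientable or not, decomposed into vertex-discs and edge-ribbons. \textbf{Relative plane graph of a projection.} Let $\pi:R\to\mathbb R^2$ be a projection that is one-to-one except that a ribbon may twist over itself (a transversal interval of the ribbon is mapped to a point) and the images of two portions of ribbons may cross (the map is two-to-one over the disc of intersection). On each ribbon choose one portion on which $\pi$ is one-to-one. The vertices of $G$ are the pieces into which the chosen portions and the singularities cut the image of $R$ (each vertex-disc together with the adjacent portions of ribbons, and the remaining portions of ribbons). Each chosen portion gives a regular edge joining the two pieces adjacent to it. The 0-edges of $G$ correspond to the double points of $\pi|_{\partial R}$: the one at a twist joins the two adjacent portions of the ribbon, and each of the four at a crossing joins the two of the four outgoing portions that meet there. \textbf{Ribbon graph arising from a relative plane graph.} Let $G$ be a relative plane graph with 0-edges $H$. The medial graph of the plane graph $(V(G),H)$ is an immersion of circles whose double points are the midpoints of the 0-edges (an isolated vertex gives one circle). These circles bound the vertex-discs of $R$. At each end of a regular edge mark an arrow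 on the circle passing there, directed counterclockwise around the vertex of $G$. Pull the circles apart, and for each regular edge attach a ribbon along its two arrows, so that each free side of the ribbon joins the head of one arrow to the tail of the other. \textbf{Polynomials.} Let every regular edge $e$ of $G$ carry weights $x_e,y_e$, and give the same weights to the corresponding ribbon of $R$. Let $v$, $k$, $bc$ denote the numbers of vertices, connected components and boundary components, and $n(F)=|F|-v+k(F)$ the nullity of a spanning subgraph. Put $$B_R(X,Y,Z)=\sum_{F\subseteq R}\Big(\prod_{e\in F}x_e\Big)\Big(\prod_{e\notin F}y_e\Big)X^{k(F)-k(R)}Y^{n(F)}Z^{k(F)-bc(F)+n(F)},$$ $$T_{G,H}(X,Y)=\sum_{F\subseteq E(G)\setminus H}\Big(\prod_{e\in F}x_e\Big)\Big(\prod_{e\notin F\cup H}y_e\Big)X^{k(F\cup H)-k(G)}Y^{n(F)}\,d^{\,\delta(H_F)-k(H_F)}\,w^{\,v(H_F)-k(H_F)}.$$ Here $H_F$ is the plane graph obtained from $(V(G),F\cup H)$ by contracting the edges of $F$ one after another, in any order, where to contract a loop means to delete it, and $\delta(H_F)$ is the number of circles that immerse to the medial graph of $H_F$. \textbf{Theorem.}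 Let $R$ be a ribbon graph and $G$ a relative plane graph, with set of 0-edges $H$, and suppose that $G$ is the relative plane graph of a projection of $R$, or that $R$ is the ribbon graph arising from $G$. Then, for every choice of the orders of contraction and of the square roots $\sqrt X,\sqrt Y$, under the substitution $w=\sqrt{X/Y}=\sqrt X/\sqrt Y$, $d=\sqrt{XY}=\sqrt X\sqrt Y$, $$X^{\alpha}Y^{\beta}\,T_{G,H}(X,Y)=B_R\Big(X,Y,\frac1{\sqrt{XY}}\Big),$$ where $\beta=-\tfrac12\,(v(R)-v(G))$ and $\alpha=k(G)-k(R)-\beta$. (The identity holds for weights in any commutative ring and any units $\sqrt X,\sqrt Y$ of it.) -/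

import Mathlib

/-!
Rotation systems, plane graphs, ribbon graphs, plane projections of ribbon graphs, and the
doubly weighted relative Tutte and Bollobás-Riordan polynomials.
All graphs are finite; loops and multiple edges are allowed.
-/

/-- The two half-edges (darts) of every edge. -/
abbrev Dart (E : Type*) := E × Bool

/-- The other half of the same edge. -/
def Dart.flip {E : Type*} (d : Dart E) : Dart E := (d.1, !d.2)

/-- A side of a dart, seen from the vertex the dart emanates from:
`true` is the left (counterclockwise) side and `false` is the right (clockwise) side. -/
abbrev DartSide (E : Type*) := Dart E × Bool

/-- Raw data of a graph drawn on an oriented surface. The vertices are `verts`, the edges are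
`edges`, the dart `d` emanates from `tail d`, and `rot` is the counterclockwise rotation.
The darts of an edge outside `edges` are only unmarked points in the cyclic order around their
vertex; the rotation of the graph is obtained from `rot` by skipping them. So an edge is deleted
by removing it from `edges`. -/
structure EmbGraph (V E : Type*) where
  verts : Finset V
  edges : Finset E
  tail : Dart E → V
  rot : Equiv.Perm (Dart E)

namespace EmbGraph

/-- Number of connected components of the spanning subgraph with edge set `S`. -/
noncomputable def components {V E : Type*} (G : EmbGraph V E) (S : Finset E) : ℕ :=
  Nat.card (Quot (fun u v : {v : V // v ∈ G.verts} =>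
    ∃ e ∈ S, ∃ b : Bool, G.tail (e, b) = u.1 ∧ G.tail (e, !b) = v.1))

/-- Nullity of the spanning subgraph with edge set `S`. -/
noncomputable def nullity {V E : Type*} (G : EmbGraph V E) (S : Finset E) : ℤ :=
  (S.card : ℤ) - (G.verts.card : ℤ) + (G.components S : ℤ)

/-- Number of vertices without any darts. -/
noncomputable def bare {V E : Type*} (G : EmbGraph V E) : ℕ :=
  Nat.card {v : V // v ∈ G.verts ∧ ∀ d : Dart E, G.tail d ≠ v}

/-- The angle at a vertex between a dart and its successor has two ends: the left side of the
dart and the right side of its successor. `corner` exchanges these ends. -/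
def corner {V E : Type*} (G : EmbGraph V E) : DartSide E → DartSide E
  | (d, true) => (G.rot d, false)
  | (d, false) => (G.rot.symm d, true)

/-- Number of faces, where all edges of `E` count as present, and where faces are counted
separately for each connected component of the graph. -/
noncomputable def faces {V E : Type*} (G : EmbGraph V E) : ℕ :=
  Nat.card (Quot (fun d d' : Dart E => d' = G.rot.symm d.flip)) + G.bare

/-- One step along the curves that trace the medial graph of the spanning subgraph with edge
set `S`. A curve runs through the angles at the vertices; at the midpoint of an edge in `S`
it goes straight ahead through the double point, to the same side of the opposite dart; at the
dart of an edge outside `S` it passes by. -/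
def medialStep {V E : Type*} (G : EmbGraph V E) (S : Finset E) (f g : DartSide E) : Prop :=
  g = G.corner f ∨ (f.1.1 ∈ S ∧ g = (f.1.flip, f.2)) ∨ (f.1.1 ∉ S ∧ g = (f.1, !f.2))

/-- Number of circles that immerse to the medial graph of the spanning subgraph with edge
set `S`. An isolated vertex gives one circle. -/
noncomputable def medialCircles {V E : Type*} (G : EmbGraph V E) (S : Finset E) : ℕ :=
  Nat.card (Quot (G.medialStep S)) + G.bare

/-- The subgraph with edge set `S` (and the same vertices). -/
def restrict {V E : Type*} (G : EmbGraph V E) (S : Finset E) : EmbGraph V E :=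
  { G with edges := S }

/-- Contraction of an edge. A loop is deleted. If the edge is not a loop, its two ends are merged,
and `… p, d, q, …` and `… p', d', q', …`, where `d, d'` are the darts of the edge, become
the cyclic order `… p, q', …, p', q, …`. -/
def contract {V E : Type*} [DecidableEq V] [DecidableEq E] (G : EmbGraph V E) (e : E) :
    EmbGraph V E :=
  if G.tail (e, false) = G.tail (e, true) then
    { G with edges := G.edges.erase e }
  else
    { verts := G.verts.erase (G.tail (e, true))
      edges := G.edges.erase e
      tail := fun d => if G.tail d = G.tail (e, true) then G.tail (e, false) else G.tail d
      rot := G.rot * Equiv.swap (e, false) (e, true) }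

/-- Contraction of the edges of a list, one after the other. -/
def contractList {V E : Type*} [DecidableEq V] [DecidableEq E] (G : EmbGraph V E)
    (l : List E) : EmbGraph V E :=
  l.foldl contract G

/-- `G.Arc H f g`: the medial curve of the spanning subgraph `H`, followed from `f` through the
angle at `f`, reaches `g` and has passed only double points of `H` between `f` and `g`. -/
inductive Arc {V E : Type*} (G : EmbGraph V E) (H : Finset E) : DartSide E → DartSide E → Prop
  | start (f : DartSide E) : Arc G H f (G.corner f)
  | cross {f g : DartSide E} : Arc G H f g → g.1.1 ∈ H → Arc G H f (G.corner (g.1.flip, g.2))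

end EmbGraph

/-- A plane graph with vertex set `V` and edge set `E`, as a rotation system (combinatorial map)
of genus zero: the cycles of `rot` are the sets of darts at the non-isolated vertices, and
Euler's formula `v - e + f = 2 k` says that each connected component is drawn in the sphere.
The mutual position of different components is not recorded. -/
structure PlaneGraph (V E : Type*) [Fintype V] [Fintype E] where
  tail : Dart E → V
  rot : Equiv.Perm (Dart E)
  sameCycle_iff : ∀ d d' : Dart E, rot.SameCycle d d' ↔ tail d = tail d'
  euler : Fintype.card V + (EmbGraph.mk Finset.univ Finset.univ tail rot).faces =
    Fintype.card E +
      2 * (EmbGraph.mk Finset.univ Finset.univ tail rot).components Finset.univ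

/-- The underlying raw data. -/
def PlaneGraph.emb {V E : Type*} [Fintype V] [Fintype E] (G : PlaneGraph V E) : EmbGraph V E :=
  ⟨Finset.univ, Finset.univ, G.tail, G.rot⟩

/-- A relative plane graph: a plane graph with a distinguished set of edges, the 0-edges.
The other edges are called regular. -/
structure RelPlaneGraph (V E : Type*) [Fintype V] [Fintype E] extends PlaneGraph V E where
  zeroEdges : Finset E

namespace RelPlaneGraph

/-- The plane graph `H_F`: the subgraph `F ∪ H` with all edges of `F` contracted, in the order
in which the list `l` names them. -/
def contracted {V E : Type*} [Fintype V] [Fintype E] [DecidableEq V] [DecidableEq E]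
    (G : RelPlaneGraph V E) (F : Finset E) (l : List E) : EmbGraph V E :=
  (G.emb.restrict (F ∪ G.zeroEdges)).contractList l

/-- The doubly weighted relative Tutte polynomial `T_{G,H}(X, Y)`, with edge weights `x`, `y`
(only those of the regular edges matter), for
`ψ(H_F) = d ^ (δ(H_F) - k(H_F)) * w ^ (v(H_F) - k(H_F))`.
The list `ord F` is the order in which the edges of `F` are contracted. -/
noncomputable def tutte {V E K : Type*} [Fintype V] [Fintype E] [DecidableEq V] [DecidableEq E]
    [CommRing K] (G : RelPlaneGraph V E) (ord : Finset E → List E) (x y : E → K)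
    (w d X Y : Kˣ) : K :=
  ∑ F ∈ (G.zeroEdgesᶜ).powerset,
    (∏ e ∈ F, x e) * (∏ e ∈ (F ∪ G.zeroEdges)ᶜ, y e) *
      ((X ^ ((G.emb.components (F ∪ G.zeroEdges) : ℤ) -
          (G.emb.components Finset.univ : ℤ)) *
        Y ^ (G.emb.nullity F) *
        (d ^ (((G.contracted F (ord F)).medialCircles (G.contracted F (ord F)).edges : ℤ) -
            ((G.contracted F (ord F)).components (G.contracted F (ord F)).edges : ℤ)) *
          w ^ (((G.contracted F (ord F)).verts.card : ℤ) -
            ((G.contracted F (ord F)).components (G.contracted F (ord F)).edges : ℤ))) : Kˣ) : K)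

end RelPlaneGraph

/-- The corners `(e, b, s)` of the ribbons `e`, each ribbon being a rectangle: `b` tells at which
of the two ends (the sides glued to vertex-discs) the corner lies, and `s` on which of the
two free sides. -/
abbrev Corner (E : Type*) := E × Bool × Bool

/-- The other corner at the same end of the ribbon. -/
def Corner.across {E : Type*} (c : Corner E) : Corner E := (c.1, c.2.1, !c.2.2)

/-- The other corner on the same free side of the ribbon. -/
def Corner.along {E : Type*} (c : Corner E) : Corner E := (c.1, !c.2.1, c.2.2)

/-- A ribbon graph, orientable or not, with set of edge-ribbons `E`. The boundary circles of the
vertex-discs with at least one ribbon consist alternately of ends of ribbons and of arcs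
joining two corners, and `link` sends each corner to the other end of its arc. `isolated` is the
number of vertex-discs without ribbons. -/
structure RibbonGraph (E : Type*) where
  link : Corner E → Corner E
  link_link : ∀ c, link (link c) = c
  link_ne : ∀ c, link c ≠ c
  isolated : ℕ

namespace RibbonGraph

/-- Number of vertex-discs. -/
noncomputable def vertices {E : Type*} (R : RibbonGraph E) : ℕ :=
  Nat.card (Quot (fun c c' : Corner E => c' = R.link c ∨ c' = c.across)) + R.isolated

/-- Number of connected components of the spanning subgraph with ribbons `F`. -/
noncomputable def components {E : Type*} (R : RibbonGraph E) (F : Finset E) : ℕ :=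
  Nat.card (Quot (fun c c' : Corner E =>
    c' = R.link c ∨ c' = c.across ∨ (c.1 ∈ F ∧ c' = c.along))) + R.isolated

/-- Number of boundary components of the spanning subgraph with ribbons `F`. -/
noncomputable def boundary {E : Type*} (R : RibbonGraph E) (F : Finset E) : ℕ :=
  Nat.card (Quot (fun c c' : Corner E =>
    c' = R.link c ∨ (c.1 ∈ F ∧ c' = c.along) ∨ (c.1 ∉ F ∧ c' = c.across))) + R.isolated

/-- Nullity of the spanning subgraph with ribbons `F`. -/
noncomputable def nullity {E : Type*} (R : RibbonGraph E) (F : Finset E) : ℤ :=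
  (F.card : ℤ) - (R.vertices : ℤ) + (R.components F : ℤ)

/-- The doubly weighted Bollobás-Riordan polynomial `B_R(X, Y, Z)` with edge weights `x`, `y`. -/
noncomputable def bollobasRiordan {E K : Type*} [Fintype E] [DecidableEq E] [CommRing K]
    (R : RibbonGraph E) (x y : E → K) (X Y Z : Kˣ) : K :=
  ∑ F : Finset E, (∏ e ∈ F, x e) * (∏ e ∈ Fᶜ, y e) *
    ((X ^ ((R.components F : ℤ) - (R.components Finset.univ : ℤ)) *
      Y ^ (R.nullity F) *
      Z ^ ((R.components F : ℤ) - (R.boundary F : ℤ) + R.nullity F) : Kˣ) : K)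

/-- `R` is the ribbon graph arising from the relative plane graph `G`, where the ribbon `e` comes
from the regular edge `ε e`. The vertex-discs of `R` bound the circles that immerse to the medial
graph of the 0-edges. At each dart of a regular edge an arrow runs counterclockwise along such
a circle, from the right to the left side of the dart, and a ribbon is attached to the two arrows
of each regular edge: its free sides join the left side of each dart to the right side of the
opposite dart. The map `φ` identifies the corners of the ribbons with the sides of the darts of
the regular edges. -/
def ArisesFrom {V E E' : Type*} [Fintype V] [Fintype E] (R : RibbonGraph E')
    (G : RelPlaneGraph V E) (ε : E' ≃ {e : E // e ∉ G.zeroEdges}) : Prop :=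
  ∃ φ : Corner E' → DartSide E,
    (∀ c, (φ c).1.1 = (ε c.1).1) ∧
    (∀ c, φ c.across = ((φ c).1, !(φ c).2)) ∧
    (∀ c, φ c.along = ((φ c).1.flip, !(φ c).2)) ∧
    (∀ c, G.emb.Arc G.zeroEdges (φ c) (φ (R.link c))) ∧
    -- circles without arrows
    R.isolated = Nat.card {q : Quot (G.emb.medialStep G.zeroEdges) //
      ∀ f : DartSide E, Quot.mk _ f = q → f.1.1 ∈ G.zeroEdges} + G.emb.bare

end RibbonGraph

/-- The kinds of nodes of the plane picture of a projected ribbon graph: images of the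
vertex-discs, the chosen regular portions of the ribbons, points where a ribbon twists over
itself by a half-turn, and discs where two portions of ribbons cross. -/
inductive NodeKind
  | disc
  | regular
  | twist
  | crossing

/-- The plane picture of a projection of a ribbon graph to the plane, in which a regular portion
of each ribbon has been chosen. Its nodes are as in `NodeKind`, and its edges `A` are the
portions of ribbons between consecutive nodes. -/
structure RibbonPicture (N A : Type*) [Fintype N] [Fintype A] extends PlaneGraph N A where
  kind : N → NodeKind
  exists_dart : ∀ n, kind n ≠ NodeKind.disc → ∃ d, tail d = n
  regular_deg : ∀ d, kind (tail d) = NodeKind.regular → rot d ≠ d ∧ rot (rot d) = d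
  twist_deg : ∀ d, kind (tail d) = NodeKind.twist → rot d ≠ d ∧ rot (rot d) = d
  crossing_deg : ∀ d, kind (tail d) = NodeKind.crossing →
    rot (rot d) ≠ d ∧ rot (rot (rot (rot d))) = d

namespace RibbonPicture

/-- A side of the ribbon arrives at a node on the side `f`, and leaves it on the
side `pass f`. It goes straight ahead, and it changes sides at a twist.
(Left and right are those of the dart pointing away from the node, so that going straight
ahead exchanges the names of the sides.) -/
def pass {N A : Type*} [Fintype N] [Fintype A] (D : RibbonPicture N A) (f : DartSide A) : DartSide A :=
  match D.kind (D.tail f.1) with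
  | NodeKind.disc => f
  | NodeKind.regular => (D.rot f.1, !f.2)
  | NodeKind.twist => (D.rot f.1, f.2)
  | NodeKind.crossing => (D.rot (D.rot f.1), !f.2)

/-- `D.Line f g`: the side `f` of the ribbon, followed away from the node of `f`, arrives at the
node of `g` on the side `g`, with no vertex-disc in between. -/
inductive Line {N A : Type*} [Fintype N] [Fintype A] (D : RibbonPicture N A) :
    DartSide A → DartSide A → Prop
  | start (f : DartSide A) : Line D f (f.1.flip, !f.2)
  | step {f g : DartSide A} : Line D f g → D.kind (D.tail g.1) ≠ NodeKind.disc →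
      Line D f ((D.pass g).1.flip, !(D.pass g).2)

/-- `D` is the picture of a projection of `R`, and `φ` tells where the corners of the ribbons
are: on both sides of each dart that emanates from a vertex-disc. -/
structure IsProjection {N A E : Type*} [Fintype N] [Fintype A] (D : RibbonPicture N A)
    (R : RibbonGraph E) (φ : Corner E → DartSide A) : Prop where
  injective : Function.Injective φ
  range_iff : ∀ f, (∃ c, φ c = f) ↔ D.kind (D.tail f.1) = NodeKind.disc
  across : ∀ c, φ c.across = ((φ c).1, !(φ c).2)
  link : ∀ c, φ (R.link c) = D.emb.corner (φ c)
  along : ∀ c, D.Line (φ c) (φ c.along)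
  isolated : R.isolated = D.emb.bare
  -- every edge of the picture is a portion of a ribbon
  covered : ∀ a : A, ∃ c f, D.Line (φ c) f ∧ f.1.1 = a
  -- every ribbon has exactly one regular portion
  regular : ∀ e : E, ∃! n : N, D.kind n = NodeKind.regular ∧
    ∃ b s f, D.Line (φ (e, b, s)) f ∧ D.tail f.1 = n

/-- The vertices of the relative plane graph of a projection are the vertex-discs together with
the adjacent portions of ribbons, and the remaining portions. Its darts are pairs `(y, t)`, where
`y` is a dart of the picture that emanates from a node that is not a disc.
At a regular portion or a twist there is the one dart `(y, false)`. At a crossing, the portion `y`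
has a double point on either side: `(y, false)` ends in the one on the left of `y`,
`(y, true)` in the one on the right of `y`. -/
def IsEnd {N A : Type*} [Fintype N] [Fintype A] (D : RibbonPicture N A)
    (p : Dart A × Bool) : Prop :=
  D.kind (D.tail p.1) ≠ NodeKind.disc ∧
    (p.2 = true → D.kind (D.tail p.1) = NodeKind.crossing)

/-- The opposite dart. A regular edge joins the two portions adjacent to a regular portion, a
0-edge the two portions at a twist, and at a crossing each of the four double points gives
a 0-edge joining the two cyclically neighbouring portions that meet there. -/
def endMate {N A : Type*} [Fintype N] [Fintype A] (D : RibbonPicture N A)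
    (p : Dart A × Bool) : Dart A × Bool :=
  match D.kind (D.tail p.1), p.2 with
  | NodeKind.crossing, false => (D.rot p.1, true)
  | NodeKind.crossing, true => (D.rot.symm p.1, false)
  | _, _ => (D.rot p.1, false)

/-- The first end met after the end `y` when one runs counterclockwise around a vertex of the
relative plane graph: the other end of the same portion, or, if that is at a vertex-disc, the far
end of the next portion counterclockwise around the disc. -/
def nextEnd {N A : Type*} [Fintype N] [Fintype A] (D : RibbonPicture N A) (y : Dart A) : Dart A :=
  match D.kind (D.tail y.flip) with
  | NodeKind.disc => (D.rot y.flip).flip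
  | _ => y.flip

/-- The counterclockwise rotation of the darts of the relative plane graph. -/
def endRot {N A : Type*} [Fintype N] [Fintype A] (D : RibbonPicture N A)
    (p : Dart A × Bool) : Dart A × Bool :=
  match D.kind (D.tail p.1), p.2 with
  | NodeKind.crossing, false => (p.1, true)
  | _, _ => (D.nextEnd p.1, false)

/-- `G` is the relative plane graph constructed from the picture `D`, and `ψ` identifies its
darts with those described above. -/
structure IsRelPlaneGraph {N A V E : Type*} [Fintype N] [Fintype A] [Fintype V] [Fintype E]
    (D : RibbonPicture N A) (G : RelPlaneGraph V E) (ψ : Dart E → Dart A × Bool) : Prop where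
  injective : Function.Injective ψ
  range_iff : ∀ p, (∃ g, ψ g = p) ↔ D.IsEnd p
  flip : ∀ g : Dart E, ψ g.flip = D.endMate (ψ g)
  rot : ∀ g : Dart E, ψ (G.rot g) = D.endRot (ψ g)
  bare : G.emb.bare = D.emb.bare
  zero_iff : ∀ g : Dart E, g.1 ∈ G.zeroEdges ↔ D.kind (D.tail (ψ g).1) ≠ NodeKind.regular

end RibbonPicture

/-- `G` is the relative plane graph of some projection of the ribbon graph `R`, with some choice
of regular portions of the ribbons, where the regular portion of `e` is the edge `ε e` of `G`. -/
def RelPlaneGraph.IsOfProjection {V E E' : Type*} [Fintype V] [Fintype E]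
    (G : RelPlaneGraph V E) (R : RibbonGraph E') (ε : E' ≃ {e : E // e ∉ G.zeroEdges}) : Prop :=
  ∃ (m n : ℕ) (D : RibbonPicture (Fin m) (Fin n)) (φ : Corner E' → DartSide (Fin n))
    (ψ : Dart E → Dart (Fin n) × Bool),
    D.IsProjection R φ ∧ D.IsRelPlaneGraph G ψ ∧
      ∀ (e : E') (b : Bool), ∃ b' s f, D.Line (φ (e, b', s)) f ∧ f.1 = (ψ ((ε e).1, b)).1

/-! The two sums agree term by term, a set of ribbons being matched with the set `F` of the
corresponding regular edges. After the substitution each term is a monomial in √X and √Y. On the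
Tutte side k(F ∪ H) cancels from both exponents, and on the other side so does the number of
components of the ribbon subgraph. The number k(R) is only a common shift, so components of `R` are
never compared with those of `G`. With v(H_F) = k(F) and k(H_F) = k(F ∪ H), what remains is the
single identity bc(F) = δ(H_F) + |F| - v(G) + k(F).

Both sides of it are compared with the number of curves of `curveStep`: the boundary of the surface
made of discs along the medial curves of the 0-edges and of ribbons along `F`, isolated vertices
being counted separately. `RibbonGraph.boundary_eq` says that this boundary is that of the ribbon
subgraph, for both ways of relating `R` and `G`. `EmbGraph.contractList_spec` follows the curves
while `F` is contracted. Contracting an edge that is not a loop keeps the curves and loses a vertex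
(`card_curves_contract`). Removing a loop keeps the vertices and loses a curve (`card_curves_loop`).

Only the loop step needs planarity. A loop separates the sphere, so the two sides of its ribbon lie
on different curves, and a curve that crosses the loop must cross back, so that deletion fuses
exactly these two. Planarity enters as `Exact`, a homological statement modulo 2 that survives
deletion and contraction and that `exact_emb` derives from Euler's formula by a dimension count. -/

theorem Quot.iff_of_mk_eq {S : Type*} {r : S → S → Prop} {A : S → Prop}
    (h : ∀ f g, r f g → (A f ↔ A g)) {f g : S} (e : Quot.mk r f = Quot.mk r g) : A f ↔ A g := by
  have := congrArg (Quot.lift A fun f g hr => propext (h f g hr)) e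
  exact iff_of_eq this

theorem Dart.flip_flip {E : Type*} (d : Dart E) : d.flip.flip = d := by
  simp [Dart.flip]

theorem Dart.flip_ne {E : Type*} (d : Dart E) : d.flip ≠ d := by
  intro h
  have := congrArg Prod.snd h
  simp [Dart.flip] at this

theorem Dart.flip_fst {E : Type*} (d : Dart E) : d.flip.1 = d.1 := rfl

/-! ### Exactness modulo 2: cycles as boundaries of sets of faces. -/

namespace EmbGraph

theorem corner_corner {V E : Type*} (G : EmbGraph V E) (f : DartSide E) :
    G.corner (G.corner f) = f := by
  rcases f with ⟨d, _ | _⟩ <;> simp [corner]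

theorem corner_snd {V E : Type*} (G : EmbGraph V E) (f : DartSide E) :
    (G.corner f).2 = !f.2 := by
  rcases f with ⟨d, _ | _⟩ <;> rfl

/-- Every cycle modulo 2 is the boundary of a set of faces; `c` is the indicator function of this
set, on the sides of the darts. -/
def Exact {V E : Type*} [DecidableEq V] [Fintype E] (G : EmbGraph V E) : Prop :=
  ∀ z : E → ZMod 2, (∀ e, e ∉ G.edges → z e = 0) →
    (∀ v, ∑ e, ((if G.tail (e, false) = v then 1 else 0) +
      (if G.tail (e, true) = v then 1 else 0)) * z e = 0) →
    ∃ c : DartSide E → ZMod 2, (∀ f, c (G.corner f) = c f) ∧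
      (∀ d, c (d, true) + c (d, false) = z d.1) ∧
      ∀ f, f.1.1 ∈ G.edges → c (f.1.flip, !f.2) = c f

theorem Exact.restrict {V E : Type*} [DecidableEq V] [Fintype E] {G : EmbGraph V E}
    (h : G.Exact) {S : Finset E} (hS : S ⊆ G.edges) : (G.restrict S).Exact := by
  intro z hz hv
  obtain ⟨c, h1, h2, h3⟩ := h z (fun e he => hz e fun h' => he (hS h')) hv
  exact ⟨c, h1, h2, fun f hf => h3 f (hS hf)⟩

end EmbGraph

/-! ### Exactness of plane graphs from Euler's formula. -/

namespace PlaneGraph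

variable {V E : Type*} [Fintype V] [Fintype E]

theorem tail_rot (G : PlaneGraph V E) (d : Dart E) : G.tail (G.rot d) = G.tail d :=
  ((G.sameCycle_iff _ _).1 ⟨1, by simp⟩).symm

/-- The map that sends a function on the faces to its jump across the edges. -/
noncomputable def faceJump (G : PlaneGraph V E) :
    (Quot (fun d d' : Dart E => d' = G.rot.symm d.flip) → ZMod 2) →ₗ[ZMod 2] (E → ZMod 2) where
  toFun w e := w (Quot.mk _ (e, true)) + w (Quot.mk _ (e, false))
  map_add' w w' := by ext e; simp only [Pi.add_apply]; ring
  map_smul' a w := by ext e; simp only [Pi.smul_apply, smul_eq_mul, RingHom.id_apply]; ring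

theorem faceJump_fst (G : PlaneGraph V E)
    (w : Quot (fun d d' : Dart E => d' = G.rot.symm d.flip) → ZMod 2) (d : Dart E) :
    G.faceJump w d.1 = w (Quot.mk _ d) + w (Quot.mk _ d.flip) := by
  rcases d with ⟨e, _ | _⟩
  · exact add_comm _ _
  · rfl

/-- The incidence matrix modulo 2. -/
def incidence [DecidableEq V] (G : PlaneGraph V E) : Matrix V E (ZMod 2) := fun v e =>
  (if G.tail (e, false) = v then 1 else 0) + (if G.tail (e, true) = v then 1 else 0)

theorem face_rot (G : PlaneGraph V E) (d : Dart E) :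
    (Quot.mk (fun d d' : Dart E => d' = G.rot.symm d.flip) (G.rot d).flip) = Quot.mk _ d := by
  apply Quot.sound
  simp [Dart.flip_flip]

/-- Around a vertex each angle contributes the value of its face twice, once for each of its two
bounding darts; the rotation matches the two contributions, which cancel modulo 2. -/
theorem incidence_faceJump [DecidableEq V] (G : PlaneGraph V E)
    (w : Quot (fun d d' : Dart E => d' = G.rot.symm d.flip) → ZMod 2) :
    G.incidence.mulVec (G.faceJump w) = 0 := by
  ext v
  have h1 : G.incidence.mulVec (G.faceJump w) v =
      ∑ d : Dart E, (if G.tail d = v then 1 else 0) * G.faceJump w d.1 := by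
    rw [Fintype.sum_prod_type]
    simp only [Matrix.mulVec, dotProduct, incidence, Fintype.sum_bool]
    exact Finset.sum_congr rfl fun e _ => by ring
  have h2 : ∑ d : Dart E, (if G.tail d = v then 1 else 0) * w (Quot.mk _ d) =
      ∑ d : Dart E, (if G.tail d = v then 1 else 0) * w (Quot.mk _ d.flip) := by
    rw [← Equiv.sum_comp G.rot
      fun d => (if G.tail d = v then 1 else 0) * w (Quot.mk _ d.flip)]
    exact Finset.sum_congr rfl fun d _ => by rw [tail_rot, face_rot]
  rw [h1]
  simp only [faceJump_fst, mul_add, Finset.sum_add_distrib]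
  rw [h2]
  exact CharTwo.add_self_eq_zero _

theorem eq_of_tail_eq (G : PlaneGraph V E) {α : Type*} (w : Dart E → α)
    (hw : ∀ d, w (G.rot d) = w d) {d d' : Dart E} (h : G.tail d = G.tail d') : w d = w d' := by
  obtain ⟨i, rfl⟩ := (G.sameCycle_iff d d').2 h
  have key : ∀ (n : ℕ) d, w ((G.rot ^ n) d) = w d := by
    intro n
    induction n with
    | zero => simp
    | succ k ih => intro d; rw [pow_succ', Equiv.Perm.mul_apply, hw, ih]
  obtain ⟨n, rfl | rfl⟩ := i.eq_nat_or_neg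
  · rw [zpow_natCast, key]
  · rw [← key n ((G.rot ^ (-(n : ℤ))) d), ← Equiv.Perm.mul_apply, zpow_neg, zpow_natCast,
      mul_inv_cancel, Equiv.Perm.one_apply]

/-- A function on the faces without jumps is constant around each vertex and along each edge, hence
descends to the components. Bare vertices meet no face of the quotient, so their components carry
independent values; this is the summand `bare`. -/
theorem finrank_ker_faceJump (G : PlaneGraph V E) :
    Module.finrank (ZMod 2) (LinearMap.ker G.faceJump) + G.emb.bare ≤
      G.emb.components Finset.univ := by
  classical
  have hker : ∀ w ∈ LinearMap.ker G.faceJump, ∀ d, w (Quot.mk _ d) = w (Quot.mk _ d.flip) := by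
    intro w hw d
    have := congrFun (LinearMap.mem_ker.1 hw) d.1
    rw [faceJump_fst] at this
    exact CharTwo.add_eq_zero.1 this
  have htail : ∀ w ∈ LinearMap.ker G.faceJump, ∀ d d', G.tail d = G.tail d' →
      w (Quot.mk _ d) = w (Quot.mk _ d') := by
    intro w hw d d' h
    exact G.eq_of_tail_eq (fun d => w (Quot.mk _ d)) (fun d => by rw [hker w hw, face_rot]) h
  let B := {v : V // v ∈ G.emb.verts ∧ ∀ d : Dart E, G.emb.tail d ≠ v}
  let r := fun u v : {v : V // v ∈ G.emb.verts} =>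
    ∃ e ∈ (Finset.univ : Finset E), ∃ b : Bool, G.emb.tail (e, b) = u.1 ∧ G.emb.tail (e, !b) = v.1
  let val : (LinearMap.ker G.faceJump × (B → ZMod 2)) → V → ZMod 2 := fun p v =>
    if h : ∃ d, G.tail d = v then p.1.1 (Quot.mk _ h.choose)
    else p.2 ⟨v, Finset.mem_univ v, fun d hd => h ⟨d, hd⟩⟩
  have hval : ∀ p d, val p (G.tail d) = p.1.1 (Quot.mk _ d) := by
    intro p d
    have h : ∃ d', G.tail d' = G.tail d := ⟨d, rfl⟩
    simp only [val, dif_pos h]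
    exact htail _ p.1.2 _ _ h.choose_spec
  have hbare : ∀ p (v : B), val p v.1 = p.2 v := by
    intro p v
    have h : ¬ ∃ d, G.tail d = v.1 := fun ⟨d, hd⟩ => v.2.2 d hd
    simp only [val, dif_neg h, Subtype.coe_eta]
  let L : (LinearMap.ker G.faceJump × (B → ZMod 2)) →ₗ[ZMod 2] (Quot r → ZMod 2) :=
    { toFun := fun p => Quot.lift (fun v => val p v.1) (by
        rintro u v ⟨e, -, b, h1, h2⟩
        have h1' : G.tail (e, b) = u.1 := h1
        have h2' : G.tail (e, !b) = v.1 := h2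
        rw [← h1', ← h2', hval, hval]
        exact hker _ p.1.2 (e, b))
      map_add' := by
        intro p q
        ext x
        induction x using Quot.ind with
        | mk v =>
          simp only [Pi.add_apply, val]
          split_ifs <;> rfl
      map_smul' := by
        intro a p
        ext x
        induction x using Quot.ind with
        | mk v =>
          simp only [Pi.smul_apply, val, RingHom.id_apply]
          split_ifs <;> rfl }
  have hL : Function.Injective L := by
    intro p q hpq
    have h : ∀ v, val p v = val q v := fun v => congrFun hpq (Quot.mk _ ⟨v, Finset.mem_univ v⟩)
    refine Prod.ext (Subtype.ext (funext fun x => ?_)) (funext fun v => ?_)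
    · induction x using Quot.ind with
      | mk d => rw [← hval, ← hval, h]
    · rw [← hbare, ← hbare, h]
  let : Fintype (Quot r) := Fintype.ofFinite _
  let : Fintype B := Fintype.ofFinite _
  have hle := LinearMap.finrank_le_finrank_of_injective hL
  rw [Module.finrank_prod, Module.finrank_fintype_fun_eq_card, Module.finrank_fintype_fun_eq_card,
    ← Nat.card_eq_fintype_card, ← Nat.card_eq_fintype_card] at hle
  exact hle

/-- A vector in the kernel of the transpose takes equal values at the two ends of every edge, so
this kernel embeds in the functions on the components. -/
theorem card_le_rank_incidence [DecidableEq V] (G : PlaneGraph V E) :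
    Fintype.card V ≤ G.incidence.rank + G.emb.components Finset.univ := by
  classical
  let r := fun u v : {v : V // v ∈ G.emb.verts} =>
    ∃ e ∈ (Finset.univ : Finset E), ∃ b : Bool, G.emb.tail (e, b) = u.1 ∧ G.emb.tail (e, !b) = v.1
  let : Fintype (Quot r) := Fintype.ofFinite _
  have hker : ∀ h ∈ LinearMap.ker G.incidence.transpose.mulVecLin, ∀ d : Dart E,
      h (G.tail d) = h (G.tail d.flip) := by
    intro h hh
    have key : ∀ e, h (G.tail (e, false)) = h (G.tail (e, true)) := by
      intro e
      have := congrFun (LinearMap.mem_ker.1 hh) e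
      simp only [Matrix.mulVecLin_apply, Matrix.mulVec, dotProduct, Matrix.transpose_apply,
        incidence, add_mul, Finset.sum_add_distrib, ite_mul, one_mul, zero_mul,
        Finset.sum_ite_eq, Finset.mem_univ, if_true, Pi.zero_apply] at this
      exact CharTwo.add_eq_zero.1 this
    rintro ⟨e, _ | _⟩
    · exact key e
    · exact (key e).symm
  let L : LinearMap.ker G.incidence.transpose.mulVecLin →ₗ[ZMod 2] (Quot r → ZMod 2) :=
    { toFun := fun h => Quot.lift (fun v => h.1 v.1) (by
        rintro u v ⟨e, -, b, h1, h2⟩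
        have h1' : G.tail (e, b) = u.1 := h1
        have h2' : G.tail (e, !b) = v.1 := h2
        rw [← h1', ← h2']
        exact hker _ h.2 (e, b))
      map_add' := by
        intro p q
        ext x
        induction x using Quot.ind with
        | mk v => rfl
      map_smul' := by
        intro a p
        ext x
        induction x using Quot.ind with
        | mk v => rfl }
  have hL : Function.Injective L := fun p q hpq => Subtype.ext <| funext fun v =>
    congrFun hpq (Quot.mk _ ⟨v, Finset.mem_univ v⟩)
  have h1 := LinearMap.finrank_le_finrank_of_injective hL
  have h2 := LinearMap.finrank_range_add_finrank_ker G.incidence.transpose.mulVecLin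
  have h3 : G.incidence.transpose.rank = G.incidence.rank := Matrix.rank_transpose _
  rw [Matrix.rank] at h3
  rw [Module.finrank_fintype_fun_eq_card] at h1 h2
  rw [← Nat.card_eq_fintype_card] at h1
  have h4 : Nat.card (Quot r) = G.emb.components Finset.univ := rfl
  omega

/-- Boundaries are cycles. The two preceding bounds give the boundaries dimension at least f - k and
the cycles dimension at most e - v + k, and these numbers are equal by Euler's formula. -/
theorem range_faceJump [DecidableEq V] (G : PlaneGraph V E) :
    LinearMap.range G.faceJump = LinearMap.ker G.incidence.mulVecLin := by
  classical
  let : Fintype (Quot (fun d d' : Dart E => d' = G.rot.symm d.flip)) := Fintype.ofFinite _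
  apply Submodule.eq_of_le_of_finrank_le
  · rintro _ ⟨w, rfl⟩
    exact LinearMap.mem_ker.2 (G.incidence_faceJump w)
  · have h1 := LinearMap.finrank_range_add_finrank_ker G.faceJump
    have h2 := LinearMap.finrank_range_add_finrank_ker G.incidence.mulVecLin
    have h3 := G.finrank_ker_faceJump
    have h4 := G.card_le_rank_incidence
    have h5 := G.euler
    rw [Matrix.rank] at h4
    rw [Module.finrank_fintype_fun_eq_card] at h1 h2
    rw [← Nat.card_eq_fintype_card] at h1
    have h6 : (EmbGraph.mk Finset.univ Finset.univ G.tail G.rot).faces =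
      Nat.card (Quot (fun d d' : Dart E => d' = G.rot.symm d.flip)) + G.emb.bare := rfl
    have h7 : (EmbGraph.mk Finset.univ Finset.univ G.tail G.rot).components Finset.univ =
      G.emb.components Finset.univ := rfl
    omega

theorem exact_emb [DecidableEq V] (G : PlaneGraph V E) : G.emb.Exact := by
  intro z _ hv
  have hz : z ∈ LinearMap.ker G.incidence.mulVecLin := LinearMap.mem_ker.2 (funext hv)
  rw [← range_faceJump] at hz
  obtain ⟨w, rfl⟩ := hz
  -- The face orbit of a dart lies on its left; the face on its right is the one to the left of the
  -- opposite dart.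
  refine ⟨fun f => w (Quot.mk _ (if f.2 then f.1 else f.1.flip)), ?_, ?_, ?_⟩
  · rintro ⟨d, _ | _⟩
    · have := G.face_rot (G.rot.symm d)
      rw [Equiv.apply_symm_apply] at this
      exact congrArg w this.symm
    · exact congrArg w (G.face_rot d)
  · intro d
    exact (G.faceJump_fst w d).symm
  · rintro ⟨d, _ | _⟩ -
    · rfl
    · simp [Dart.flip_flip]

end PlaneGraph

/-! ### Boundary curves and the removal of a loop. -/

/-- Identifying two points of a quotient lowers its cardinality by one. -/
theorem Quot.card_merge {S : Type*} [Finite S] {r r' : S → S → Prop} {p q : S}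
    (hne : Quot.mk r p ≠ Quot.mk r q) (heq : Quot.mk r' p = Quot.mk r' q)
    (h : ∀ f g, r f g → Quot.mk r' f = Quot.mk r' g)
    (h' : ∀ f g, r' f g → Quot.mk r f = Quot.mk r g ∨
      ((Quot.mk r f = Quot.mk r p ∨ Quot.mk r f = Quot.mk r q) ∧
        (Quot.mk r g = Quot.mk r p ∨ Quot.mk r g = Quot.mk r q))) :
    Nat.card (Quot r) = Nat.card (Quot r') + 1 := by
  classical
  let ρ : Quot r → {x : Quot r // x ≠ Quot.mk r q} := fun x =>
    if hx : x = Quot.mk r q then ⟨Quot.mk r p, hne⟩ else ⟨x, hx⟩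
  have hρp : ρ (Quot.mk r p) = ⟨Quot.mk r p, hne⟩ := dif_neg hne
  have hρq : ρ (Quot.mk r q) = ⟨Quot.mk r p, hne⟩ := dif_pos rfl
  let φ : Quot r' → {x : Quot r // x ≠ Quot.mk r q} := Quot.lift (fun f => ρ (Quot.mk r f)) (by
    intro f g hfg
    rcases h' f g hfg with h1 | ⟨h1, h2⟩
    · simp only [h1]
    · rcases h1 with h1 | h1 <;> rcases h2 with h2 | h2 <;> simp only [h1, h2, hρp, hρq])
  let π : Quot r → Quot r' := Quot.lift (Quot.mk r') h
  have hπρ : ∀ x, π (ρ x).1 = π x := by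
    intro x
    by_cases hx : x = Quot.mk r q
    · rw [hx, hρq]; exact heq
    · simp only [ρ, dif_neg hx]
  have e : Quot r' ≃ {x : Quot r // x ≠ Quot.mk r q} :=
    { toFun := φ
      invFun := fun x => π x.1
      left_inv := by
        intro x
        induction x using Quot.ind with
        | mk f => exact hπρ (Quot.mk r f)
      right_inv := by
        rintro ⟨x, hx⟩
        induction x using Quot.ind with
        | mk f => exact dif_neg hx }
  rw [Nat.card_congr e, ← Finite.card_option, Nat.card_congr (Equiv.optionSubtypeNe (Quot.mk r q))]

namespace EmbGraph

variable {V E : Type*} [DecidableEq E]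

/-- The side at which a curve continues that arrives at the side `f`, along the medial graph at
the edges in `H`, along the boundary of a ribbon at the edges in `F`, and passing by the others. -/
def continuation (H F : Finset E) (f : DartSide E) : DartSide E :=
  if f.1.1 ∈ H then (f.1.flip, f.2) else if f.1.1 ∈ F then (f.1.flip, !f.2) else (f.1, !f.2)

/-- One step along the boundary curves of the surface that consists of the discs bounded by the
medial curves of `H`, and of ribbons along the edges in `F`. -/
def curveStep (G : EmbGraph V E) (H F : Finset E) (f g : DartSide E) : Prop :=
  g = G.corner f ∨ g = continuation H F f

theorem continuation_fst (H F : Finset E) (f : DartSide E) :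
    (continuation H F f).1.1 = f.1.1 := by
  unfold continuation
  split_ifs <;> rfl

theorem continuation_continuation (H F : Finset E) (f : DartSide E) :
    continuation H F (continuation H F f) = f := by
  by_cases h : f.1.1 ∈ H
  · simp [continuation, h, Dart.flip_fst, Dart.flip_flip]
  · by_cases h' : f.1.1 ∈ F <;> simp [continuation, h, h', Dart.flip_fst, Dart.flip_flip]

theorem continuation_ne (H F : Finset E) (f : DartSide E) : continuation H F f ≠ f := by
  unfold continuation
  intro h
  split_ifs at h
  · exact Dart.flip_ne _ (congrArg Prod.fst h)
  · exact Dart.flip_ne _ (congrArg Prod.fst h)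
  · simpa using congrArg Prod.snd h

theorem curveStep_symm {G : EmbGraph V E} {H F : Finset E} {f g : DartSide E}
    (h : G.curveStep H F f g) : G.curveStep H F g f := by
  rcases h with rfl | rfl
  · exact Or.inl (G.corner_corner f).symm
  · exact Or.inr (continuation_continuation H F f).symm

theorem mk_corner (G : EmbGraph V E) (H F : Finset E) (f : DartSide E) :
    Quot.mk (G.curveStep H F) (G.corner f) = Quot.mk _ f :=
  (Quot.sound (show G.curveStep H F f _ from Or.inl rfl)).symm

theorem mk_continuation (G : EmbGraph V E) (H F : Finset E) (f : DartSide E) :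
    Quot.mk (G.curveStep H F) (continuation H F f) = Quot.mk _ f :=
  (Quot.sound (show G.curveStep H F f _ from Or.inr rfl)).symm

theorem curveStep_empty (G : EmbGraph V E) (H : Finset E) :
    G.curveStep H ∅ = G.medialStep H := by
  ext f g
  by_cases h : f.1.1 ∈ H <;> simp [curveStep, medialStep, continuation, h]

section Loop

variable [Fintype E]

/-- A closed curve crosses the loop `e` an even number of times. The function `c` tells the two
sides of the loop apart, and in the relation considered a curve changes `c` only where it passes a
dart of `e`. So a curve through one dart of `e` also passes the other one. -/
theorem mk_loop_eq {G : EmbGraph V E} {H F : Finset E} {e : E} (hH : e ∉ H) (hF : e ∉ F)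
    {c : DartSide E → ZMod 2} (h1 : ∀ f, c (G.corner f) = c f)
    (h2 : ∀ f, f.1.1 ≠ e → c (continuation H F f) = c f)
    (h3 : ∀ d : Dart E, d.1 = e → c (d, true) ≠ c (d, false))
    (h4 : ∀ f, f.1.1 = e → c (f.1.flip, !f.2) = c f) (d : Dart E) (hd : d.1 = e) (s : Bool) :
    Quot.mk (G.curveStep H F) (d, s) = Quot.mk (G.curveStep H F) (d.flip, !s) := by
  classical
  by_contra hne
  have hd' : c (d, !s) ≠ c (d, s) := by
    cases s
    · exact h3 d hd
    · exact (h3 d hd).symm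
  have hcont : ∀ f : DartSide E, f.1.1 = e → continuation H F f = (f.1, !f.2) := by
    intro f hf
    simp [continuation, hf, hH, hF]
  -- The part of the curve of `(d, s)` on one side of the loop. `corner` pairs off all its points;
  -- `continuation` would pair off all but `(d, s)` if the curve missed `(d.flip, !s)`. The two
  -- parities contradict each other.
  let A := Finset.univ.filter fun f => Quot.mk (G.curveStep H F) f = Quot.mk _ (d, s) ∧
    c f = c (d, s)
  have hmem : ∀ f, f ∈ A ↔ Quot.mk (G.curveStep H F) f = Quot.mk _ (d, s) ∧ c f = c (d, s) := by
    simp [A]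
  have hA : ∑ f ∈ A, (1 : ZMod 2) = 0 := by
    refine Finset.sum_involution (fun f _ => G.corner f) (fun _ _ => by decide) ?_ ?_ ?_
    · intro f _ _ h
      have := congrArg Prod.snd h
      rw [corner_snd] at this
      simp at this
    · intro f hf
      rw [hmem] at hf ⊢
      rw [h1, ← hf.1]
      exact ⟨mk_corner G H F f, hf.2⟩
    · intro f _
      exact G.corner_corner f
  have hA' : ∑ f ∈ A.erase (d, s), (1 : ZMod 2) = 0 := by
    refine Finset.sum_involution (fun f _ => continuation H F f) (fun _ _ => by decide)
      (fun f _ _ => continuation_ne H F f) ?_ (fun f _ => continuation_continuation H F f)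
    intro f hf
    rw [Finset.mem_erase, hmem] at hf ⊢
    obtain ⟨hf1, hf2, hf3⟩ := hf
    have hmk := mk_continuation G H F f
    by_cases hfe : f.1.1 = e
    · exfalso
      -- Of the four sides of the darts of `e`, only `(d, s)` and `(d.flip, !s)` have the value `c
      -- (d, s)`.
      have hdf : f.1 = d ∨ f.1 = d.flip := by
        rcases f with ⟨⟨e1, b⟩, t⟩
        rcases d with ⟨e2, b'⟩
        simp only at hd hfe
        subst hd hfe
        cases b <;> cases b' <;> simp [Dart.flip]
      rcases f with ⟨d', t⟩
      simp only at hdf hf1 hf2 hf3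
      have hdflip : c (d.flip, !s) = c (d, s) := h4 (d, s) hd
      have hdflip' : c (d.flip, s) = c (d, !s) := by simpa using h4 (d, !s) hd
      by_cases hts : t = s
      · subst hts
        rcases hdf with rfl | rfl
        · exact hf1 rfl
        · exact hd' (by rw [← hdflip', hf3])
      · obtain rfl : t = !s := by cases t <;> cases s <;> simp_all
        rcases hdf with rfl | rfl
        · exact hd' hf3
        · exact hne hf2.symm
    · refine ⟨?_, hmk.trans hf2, (h2 f hfe).trans hf3⟩
      intro h
      have := continuation_fst H F f
      rw [h] at this
      exact hfe (this.symm.trans hd)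
  have hmemd : (d, s) ∈ A := (hmem _).2 ⟨rfl, rfl⟩
  rw [← Finset.add_sum_erase A _ hmemd, hA'] at hA
  exact absurd hA (by decide)

/-- Exactness is applied to the cycle formed by the loop alone. With a ribbon along `e` the function
`c` is constant on curves, so the two sides of the ribbon lie on different curves. Without it,
passing a dart of `e` joins these sides, and by `mk_loop_eq` no other identification is gained or
lost. -/
theorem card_curves_loop [DecidableEq V] {G : EmbGraph V E} {H F : Finset E} {e : E}
    (hG : G.Exact) (hl : G.tail (e, false) = G.tail (e, true)) (he : e ∈ G.edges) (hH : e ∉ H)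
    (hF : e ∉ F) (hHG : H ⊆ G.edges) (hFG : F ⊆ G.edges) :
    Nat.card (Quot (G.curveStep H (insert e F))) = Nat.card (Quot (G.curveStep H F)) + 1 := by
  obtain ⟨c, h1, h2, h3⟩ := hG (Pi.single e 1) (by
      intro e' he'
      exact Pi.single_eq_of_ne (by rintro rfl; exact he' he) _) (by
      intro v
      simp only [Pi.single_apply, mul_ite, mul_one, mul_zero, Finset.sum_ite_eq', Finset.mem_univ,
        if_true, hl]
      exact CharTwo.add_self_eq_zero _)
  have hne : ∀ d : Dart E, d.1 = e → c (d, true) ≠ c (d, false) := by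
    intro d hd h
    have := h2 d
    rw [h, hd, Pi.single_eq_same, CharTwo.add_self_eq_zero] at this
    exact absurd this (by decide)
  have heq : ∀ (d : Dart E) s, d.1 ≠ e → c (d, !s) = c (d, s) := by
    intro d s hd
    have := h2 d
    rw [Pi.single_eq_of_ne hd, CharTwo.add_eq_zero] at this
    cases s
    · exact this
    · exact this.symm
  have hcont : ∀ f : DartSide E, f.1.1 ≠ e → c (continuation H F f) = c f := by
    rintro ⟨d, s⟩ hf
    unfold continuation
    split_ifs with hh hh'
    · exact (heq d.flip s hf).symm.trans (h3 (d, s) (hHG hh))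
    · exact h3 (d, s) (hFG hh')
    · exact heq d s hf
  have hold : ∀ f : DartSide E, f.1.1 ≠ e →
      continuation H (insert e F) f = continuation H F f := by
    intro f hf
    simp [continuation, hf]
  have hnew : ∀ f : DartSide E, f.1.1 = e →
      continuation H (insert e F) f = (f.1.flip, !f.2) := by
    intro f hf
    simp [continuation, hf, hH]
  have hpass : ∀ f : DartSide E, f.1.1 = e → continuation H F f = (f.1, !f.2) := by
    intro f hf
    simp [continuation, hf, hH, hF]
  have hflip : ∀ f : DartSide E, f.1.1 = e → c (f.1.flip, !f.2) = c f := fun f hf =>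
    h3 f (hf ▸ he)
  have hcurve : ∀ f g, G.curveStep H (insert e F) f g → c f = c g := by
    rintro f g (rfl | rfl)
    · exact (h1 f).symm
    · by_cases hf : f.1.1 = e
      · rw [hnew f hf, hflip f hf]
      · rw [hold f hf, hcont f hf]
  have hsides : ∀ f : DartSide E, f.1.1 = e →
      Quot.mk (G.curveStep H (insert e F)) f = Quot.mk _ ((e, true), true) ∨
      Quot.mk (G.curveStep H (insert e F)) f = Quot.mk _ ((e, true), false) := by
    have hs : ∀ t, Quot.mk (G.curveStep H (insert e F)) ((e, false), t) =
        Quot.mk _ ((e, true), !t) := by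
      intro t
      refine Quot.sound (Or.inr ?_)
      rw [hnew _ rfl]
      rfl
    rintro ⟨⟨e', _ | _⟩, _ | _⟩ rfl
    · exact Or.inl (hs false)
    · exact Or.inr (hs true)
    · exact Or.inr rfl
    · exact Or.inl rfl
  refine Quot.card_merge (p := ((e, true), true)) (q := ((e, true), false)) ?_ ?_ ?_ ?_
  · intro h
    exact hne (e, true) rfl (congrArg (Quot.lift c hcurve) h)
  · refine Quot.sound (Or.inr ?_)
    rw [hpass _ rfl]
    rfl
  · rintro f g (rfl | rfl)
    · exact Quot.sound (Or.inl rfl)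
    · by_cases hf : f.1.1 = e
      · rw [hnew f hf]
        exact mk_loop_eq hH hF h1 hcont hne hflip f.1 hf f.2
      · rw [hold f hf]
        exact Quot.sound (Or.inr rfl)
  · rintro f g (rfl | rfl)
    · exact Or.inl (Quot.sound (Or.inl rfl))
    · by_cases hf : f.1.1 = e
      · exact Or.inr ⟨hsides f hf, hsides _ ((continuation_fst H F f).trans hf)⟩
      · rw [← hold f hf]
        exact Or.inl (Quot.sound (Or.inr rfl))

end Loop

/-! ### Contraction of edges. -/

section Contract

variable [DecidableEq V]

theorem contract_loop {G : EmbGraph V E} {e : E} (h : G.tail (e, false) = G.tail (e, true)) :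
    G.contract e = { G with edges := G.edges.erase e } := if_pos h

theorem contract_edges (G : EmbGraph V E) (e : E) : (G.contract e).edges = G.edges.erase e := by
  unfold contract
  split_ifs <;> rfl

theorem contract_tail {G : EmbGraph V E} {e : E} (h : G.tail (e, false) ≠ G.tail (e, true))
    (d : Dart E) : (G.contract e).tail d =
      if G.tail d = G.tail (e, true) then G.tail (e, false) else G.tail d := by
  unfold contract
  rw [if_neg h]

theorem contract_verts {G : EmbGraph V E} {e : E} (h : G.tail (e, false) ≠ G.tail (e, true)) :
    (G.contract e).verts = G.verts.erase (G.tail (e, true)) := by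
  unfold contract
  rw [if_neg h]

theorem contract_rot {G : EmbGraph V E} {e : E} (h : G.tail (e, false) ≠ G.tail (e, true)) :
    (G.contract e).rot = G.rot * Equiv.swap (e, false) (e, true) := by
  unfold contract
  rw [if_neg h]

theorem contract_tail_mem {G : EmbGraph V E} {e : E} (hG : ∀ d, G.tail d ∈ G.verts)
    (d : Dart E) : (G.contract e).tail d ∈ (G.contract e).verts := by
  by_cases h : G.tail (e, false) = G.tail (e, true)
  · rw [contract_loop h]
    exact hG d
  · rw [contract_tail h, contract_verts h]
    split_ifs with hd
    · exact Finset.mem_erase.2 ⟨h, hG _⟩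
    · exact Finset.mem_erase.2 ⟨hd, hG _⟩

/-- Darts of contracted and deleted edges stay behind as unmarked points, so no vertex becomes bare.
-/
theorem contract_bare (G : EmbGraph V E) (e : E) : (G.contract e).bare = G.bare := by
  by_cases h : G.tail (e, false) = G.tail (e, true)
  · rw [contract_loop h]
    rfl
  · unfold bare
    refine Nat.card_congr (Equiv.subtypeEquivRight fun v => ?_)
    rw [contract_verts h, Finset.mem_erase]
    simp only [contract_tail h]
    constructor
    · rintro ⟨⟨h1, h2⟩, h3⟩
      refine ⟨h2, fun d hd => h3 d ?_⟩
      rw [if_neg (hd ▸ h1), hd]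
    · rintro ⟨h2, h3⟩
      refine ⟨⟨(h3 _).symm, h2⟩, fun d => ?_⟩
      split_ifs
      · exact h3 _
      · exact h3 _

theorem contract_components {G : EmbGraph V E} {e : E} (hG : ∀ d, G.tail d ∈ G.verts)
    {S : Finset E} (heS : e ∈ S) :
    (G.contract e).components (S.erase e) = G.components S := by
  by_cases h : G.tail (e, false) = G.tail (e, true)
  · rw [contract_loop h]
    unfold components
    refine Nat.card_congr
      { toFun := Quot.lift (Quot.mk _) ?_
        invFun := Quot.lift (Quot.mk _) ?_
        left_inv := fun x => by induction x using Quot.ind with | mk v => rfl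
        right_inv := fun x => by induction x using Quot.ind with | mk v => rfl }
    · rintro u v ⟨e', he', b, h1, h2⟩
      exact Quot.sound ⟨e', Finset.mem_of_mem_erase he', b, h1, h2⟩
    · rintro u v ⟨e', he', b, h1, h2⟩
      by_cases hee : e' = e
      · subst hee
        have : u = v := Subtype.ext <| by
          rw [← h1, ← h2]
          cases b
          · exact h
          · exact h.symm
        rw [this]
      · exact Quot.sound ⟨e', Finset.mem_erase.2 ⟨hee, he'⟩, b, h1, h2⟩
  · let π : {v // v ∈ G.verts} → {v // v ∈ (G.contract e).verts} := fun v =>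
      if hv : v.1 = G.tail (e, true) then
        ⟨G.tail (e, false), by rw [contract_verts h]; exact Finset.mem_erase.2 ⟨h, hG _⟩⟩
      else ⟨v.1, by rw [contract_verts h]; exact Finset.mem_erase.2 ⟨hv, v.2⟩⟩
    have hπ : ∀ v, (π v).1 = if v.1 = G.tail (e, true) then G.tail (e, false) else v.1 := by
      intro v
      simp only [π]
      split_ifs <;> rfl
    have hmem : ∀ v, v ∈ (G.contract e).verts → v ∈ G.verts := fun v hv => by
      rw [contract_verts h] at hv
      exact Finset.mem_of_mem_erase hv
    let ι : {v // v ∈ (G.contract e).verts} → {v // v ∈ G.verts} := fun v => ⟨v.1, hmem _ v.2⟩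
    have hne : ∀ v : {v // v ∈ (G.contract e).verts}, v.1 ≠ G.tail (e, true) := fun v hv => by
      have hv' := v.2
      rw [hv, contract_verts h] at hv'
      exact Finset.notMem_erase _ _ hv'
    let r := fun u v : {v : V // v ∈ G.verts} =>
      ∃ e ∈ S, ∃ b : Bool, G.tail (e, b) = u.1 ∧ G.tail (e, !b) = v.1
    have hr : ∀ v, Quot.mk r (ι (π v)) = Quot.mk r v := by
      intro v
      by_cases hv : v.1 = G.tail (e, true)
      · refine Quot.sound ⟨e, heS, false, ?_, hv.symm⟩
        exact ((hπ v).trans (if_pos hv)).symm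
      · exact congrArg _ (Subtype.ext ((hπ v).trans (if_neg hv)))
    symm
    refine Nat.card_congr
      { toFun := Quot.lift (fun v => Quot.mk _ (π v)) ?_
        invFun := Quot.lift (fun v => Quot.mk _ (ι v)) ?_
        left_inv := fun x => by
          induction x using Quot.ind with
          | mk v => exact hr v
        right_inv := fun x => by
          induction x using Quot.ind with
          | mk v => exact congrArg _ (Subtype.ext ((hπ (ι v)).trans (if_neg (hne v)))) }
    · rintro u v ⟨e', he', b, h1, h2⟩
      by_cases hee : e' = e
      · subst hee
        have : π u = π v := by
          apply Subtype.ext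
          rw [hπ, hπ, ← h1, ← h2]
          cases b <;> simp
        rw [this]
      · refine Quot.sound ⟨e', Finset.mem_erase.2 ⟨hee, he'⟩, b, ?_, ?_⟩
        · rw [contract_tail h, hπ, h1]
        · rw [contract_tail h, hπ, h2]
    · rintro u v ⟨e', he', b, h1, h2⟩
      let a : Bool → {v // v ∈ G.verts} := fun b => ⟨G.tail (e', b), hG _⟩
      have ha : ∀ b (w : {v // v ∈ (G.contract e).verts}),
          (G.contract e).tail (e', b) = w.1 → Quot.mk r (ι w) = Quot.mk r (a b) := by
        intro b w hw
        rw [← hr (a b)]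
        refine congrArg _ (Subtype.ext ?_)
        change w.1 = (π (a b)).1
        rw [hπ, ← hw, contract_tail h]
      rw [ha b u h1, ha (!b) v h2]
      exact Quot.sound ⟨e', Finset.mem_of_mem_erase he', b, rfl, rfl⟩

/-- Two discs joined by a ribbon form one disc with the same boundary. The darts of `e` remain as
unmarked points in the two angles where the boundaries of the old discs were joined, which are the
two free sides of the ribbon. -/
theorem card_curves_contract {G : EmbGraph V E} {H F : Finset E} {e : E}
    (h : G.tail (e, false) ≠ G.tail (e, true)) (hH : e ∉ H) (hF : e ∉ F) :
    Nat.card (Quot ((G.contract e).curveStep H F)) =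
      Nat.card (Quot (G.curveStep H (insert e F))) := by
  -- The contracted rotation differs from the old one by the transposition of the darts of `e`,
  -- applied before it. Only left sides are sent through `rot` by `corner`, so exchanging the two
  -- left sides conjugates one system of curves into the other.
  let θ : Equiv.Perm (DartSide E) := Equiv.swap ((e, false), true) ((e, true), true)
  have hθf : ∀ d, θ (d, false) = (d, false) := fun d =>
    Equiv.swap_apply_of_ne_of_ne (by simp) (by simp)
  have hθt : ∀ d, θ (d, true) = (Equiv.swap (e, false) (e, true) d, true) := by
    intro d
    by_cases h0 : d = (e, false)
    · subst h0
      simp [θ]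
    · by_cases h1 : d = (e, true)
      · subst h1
        simp [θ]
      · rw [Equiv.swap_apply_of_ne_of_ne h0 h1]
        exact Equiv.swap_apply_of_ne_of_ne (by simpa using h0) (by simpa using h1)
  have hθ : ∀ f : DartSide E, f.1.1 ≠ e → θ f = f := by
    intro f hf
    exact Equiv.swap_apply_of_ne_of_ne (by rintro rfl; exact hf rfl) (by rintro rfl; exact hf rfl)
  have hcorner : ∀ f, θ ((G.contract e).corner f) = G.corner (θ f) := by
    rintro ⟨d, _ | _⟩
    · rw [hθf]
      simp only [corner, contract_rot h]
      rw [hθt]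
      refine Prod.ext ?_ rfl
      change Equiv.swap (e, false) (e, true) ((G.rot * Equiv.swap (e, false) (e, true))⁻¹ d) = _
      rw [mul_inv_rev, Equiv.swap_inv, Equiv.Perm.mul_apply, Equiv.swap_apply_self]
      rfl
    · rw [hθt]
      simp only [corner, contract_rot h, hθf]
      rfl
  have hcont : ∀ f, θ (continuation H F f) = continuation H (insert e F) (θ f) := by
    intro f
    by_cases hf : f.1.1 = e
    · rcases f with ⟨⟨e', b⟩, s⟩
      simp only at hf
      subst hf
      cases s
      · rw [hθf]
        simp only [continuation, hH, hF, Finset.mem_insert_self, if_false, if_true, Bool.not_false,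
          hθt]
        cases b <;> simp [Dart.flip]
      · rw [hθt]
        have : ∀ d : Dart E, d.1 = e' → continuation H (insert e' F) (d, true) =
            (d.flip, false) := by
          rintro d rfl
          simp [continuation, hH]
        rw [this _ (by cases b <;> simp)]
        simp only [continuation, hH, hF, if_false, Bool.not_true, hθf]
        cases b <;> simp [Dart.flip]
    · rw [hθ _ (by rw [continuation_fst]; exact hf), hθ f hf]
      simp [continuation, hf]
  refine Nat.card_congr (Quot.congr θ fun f g => ?_)
  unfold curveStep
  rw [← hcorner, ← hcont, θ.injective.eq_iff, θ.injective.eq_iff]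

/-- A cycle of the contracted graph lifts to a cycle of `G` with a suitable coefficient at `e`, and
the set of faces found there is carried back. The unmarked darts of `e` then lie on opposite sides
of the contracted edge, which is why `Exact` asks for invariance along the edges still present only.
-/
theorem Exact.contract [Fintype E] {G : EmbGraph V E} (hG : G.Exact) {e : E}
    (he : e ∈ G.edges) : (G.contract e).Exact := by
  by_cases h : G.tail (e, false) = G.tail (e, true)
  · rw [contract_loop h]
    exact hG.restrict (Finset.erase_subset _ _)
  intro z hz hv
  rw [contract_edges] at hz
  have hze : z e = 0 := hz e (Finset.notMem_erase _ _)
  let I : V → E → ZMod 2 := fun v e' =>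
    (if G.tail (e', false) = v then 1 else 0) + (if G.tail (e', true) = v then 1 else 0)
  -- The boundary of `z` at the end of `e` that disappears. As the boundary at the merged vertex
  -- vanishes, the other end has the same value, so adding `lam` times `e` makes `z` closed at both.
  let lam := ∑ e', I (G.tail (e, true)) e' * z e'
  have hI1 : I (G.tail (e, true)) e = 1 := by simp [I, h]
  have hI0 : I (G.tail (e, false)) e = 1 := by simp [I, Ne.symm h]
  have hsum : ∑ e', I (G.tail (e, false)) e' * z e' = lam := by
    have := hv (G.tail (e, false))
    rw [← CharTwo.add_eq_zero, ← this, ← Finset.sum_add_distrib]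
    refine Finset.sum_congr rfl fun e' _ => ?_
    simp only [contract_tail h, I]
    rw [← add_mul]
    congr 1
    by_cases h1 : G.tail (e', false) = G.tail (e, true) <;>
      by_cases h2 : G.tail (e', true) = G.tail (e, true) <;>
      (simp [h1, h2, Ne.symm h]; try ring)
  obtain ⟨c, h1, h2, h3⟩ := hG (z + Pi.single e lam) (by
      intro e' he'
      have hee : e' ≠ e := by rintro rfl; exact he' he
      rw [Pi.add_apply, Pi.single_eq_of_ne hee, add_zero]
      exact hz e' fun h' => he' (Finset.mem_of_mem_erase h')) (by
      intro v
      have hs : ∑ e', I v e' * (z + Pi.single e lam : E → ZMod 2) e' =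
          ∑ e', I v e' * z e' + I v e * lam := by
        simp only [Pi.add_apply, mul_add, Finset.sum_add_distrib, Pi.single_apply, mul_ite,
          mul_zero, Finset.sum_ite_eq', Finset.mem_univ, if_true]
      refine hs.trans ?_
      by_cases hv1 : v = G.tail (e, true)
      · subst hv1
        rw [hI1, one_mul]
        exact CharTwo.add_self_eq_zero _
      · by_cases hv0 : v = G.tail (e, false)
        · subst hv0
          rw [hI0, one_mul, hsum]
          exact CharTwo.add_self_eq_zero _
        · have hIe : I v e = 0 := by simp [I, Ne.symm hv1, Ne.symm hv0]
          rw [hIe, zero_mul, add_zero, ← hv v]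
          refine Finset.sum_congr rfl fun e' _ => ?_
          simp only [contract_tail h, I]
          congr 1
          by_cases h1 : G.tail (e', false) = G.tail (e, true) <;>
            by_cases h2 : G.tail (e', true) = G.tail (e, true) <;>
            simp [h1, h2, Ne.symm hv1, Ne.symm hv0])
  have hflip : ∀ (b s : Bool), c ((e, !b), !s) = c ((e, b), s) := fun b s => h3 ((e, b), s) he
  -- The same exchange of left sides as in `card_curves_contract`.
  refine ⟨fun f => c (if f.2 then (Equiv.swap (e, false) (e, true) f.1, true) else f), ?_, ?_, ?_⟩
  · rintro ⟨d, _ | _⟩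
    · simp only [corner, contract_rot h, if_true, Bool.false_eq_true, if_false]
      change c (Equiv.swap (e, false) (e, true)
        ((G.rot * Equiv.swap (e, false) (e, true))⁻¹ d), true) = _
      rw [mul_inv_rev, Equiv.swap_inv, Equiv.Perm.mul_apply, Equiv.swap_apply_self]
      exact h1 (d, false)
    · simp only [corner, contract_rot h, if_true, Bool.false_eq_true, if_false,
        Equiv.Perm.mul_apply]
      exact h1 (Equiv.swap (e, false) (e, true) d, true)
  · intro d
    simp only [if_true, Bool.false_eq_true, if_false]
    by_cases hd : d.1 = e
    · rcases d with ⟨e', b⟩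
      simp only at hd
      subst hd
      rw [hze]
      have : Equiv.swap (e', false) (e', true) (e', b) = (e', !b) := by cases b <;> simp
      rw [this]
      have := hflip b false
      rw [Bool.not_false] at this
      rw [this]
      exact CharTwo.add_self_eq_zero _
    · rw [Equiv.swap_apply_of_ne_of_ne (by rintro rfl; exact hd rfl) (by rintro rfl; exact hd rfl),
        h2, Pi.add_apply, Pi.single_eq_of_ne hd, add_zero]
  · rintro ⟨d, s⟩ hd
    rw [contract_edges] at hd
    have hde : d.1 ≠ e := Finset.ne_of_mem_erase hd
    have hs : ∀ d' : Dart E, d'.1 ≠ e → Equiv.swap (e, false) (e, true) d' = d' := fun d' hd' =>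
      Equiv.swap_apply_of_ne_of_ne (by rintro rfl; exact hd' rfl) (by rintro rfl; exact hd' rfl)
    have h' := h3 (d, s) (Finset.mem_of_mem_erase hd)
    simp only [hs d hde, hs d.flip hde]
    cases s <;> exact h'

theorem components_empty {V E : Type*} (G : EmbGraph V E) : G.components ∅ = G.verts.card := by
  unfold components
  rw [← Nat.card_eq_finsetCard]
  refine Nat.card_congr
    { toFun := Quot.lift id ?_
      invFun := Quot.mk _
      left_inv := fun x => by induction x using Quot.ind with | mk v => rfl
      right_inv := fun x => rfl }
  rintro u v ⟨e, he, -⟩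
  simp at he

/-- In the last equation a loop lowers the number of curves and the remaining length by one; any
other edge lowers the number of vertices and the remaining length by one. Hence the order of
contraction is irrelevant. -/
theorem contractList_spec [Fintype E] {H : Finset E} (l : List E) :
    ∀ G : EmbGraph V E, (∀ d, G.tail d ∈ G.verts) → l.Nodup → G.edges = l.toFinset ∪ H →
      Disjoint l.toFinset H → G.Exact →
      (G.contractList l).edges = H ∧
      (G.contractList l).components H = G.components G.edges ∧
      (G.contractList l).verts.card = G.components l.toFinset ∧
      (G.contractList l).bare = G.bare ∧
      Nat.card (Quot (G.curveStep H l.toFinset)) + G.verts.card =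
        Nat.card (Quot ((G.contractList l).curveStep H ∅)) + l.length +
          (G.contractList l).verts.card := by
  induction l with
  | nil =>
    intro G hG _ hE _ _
    have hE' : G.edges = H := by simpa using hE
    exact ⟨hE', by rw [hE']; rfl, (components_empty G).symm, rfl, rfl⟩
  | cons e l ih =>
    intro G hG hl hE hd hex
    rw [List.nodup_cons] at hl
    rw [List.toFinset_cons] at hE hd ⊢
    rw [Finset.disjoint_insert_left] at hd
    have hel : e ∉ l.toFinset := by simpa using hl.1
    have heG : e ∈ G.edges := by rw [hE]; simp
    have hcE : (G.contract e).edges = l.toFinset ∪ H := by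
      rw [contract_edges, hE, Finset.insert_union, Finset.erase_insert]
      simpa using ⟨hl.1, hd.1⟩
    obtain ⟨i1, i2, i3, i4, i5⟩ := ih (G.contract e) (contract_tail_mem hG) hl.2 hcE hd.2
      (hex.contract heG)
    change ((G.contract e).contractList l).edges = H ∧
      ((G.contract e).contractList l).components H = G.components G.edges ∧
      ((G.contract e).contractList l).verts.card = G.components (insert e l.toFinset) ∧
      ((G.contract e).contractList l).bare = G.bare ∧
      Nat.card (Quot (G.curveStep H (insert e l.toFinset))) + G.verts.card =
        Nat.card (Quot (((G.contract e).contractList l).curveStep H ∅)) + (l.length + 1) +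
          ((G.contract e).contractList l).verts.card
    refine ⟨i1, ?_, ?_, i4.trans (contract_bare G e), ?_⟩
    · rw [i2, contract_edges, contract_components hG heG]
    · rw [i3, ← contract_components hG (Finset.mem_insert_self e l.toFinset),
        Finset.erase_insert hel]
    · by_cases h : G.tail (e, false) = G.tail (e, true)
      · rw [card_curves_loop hex h heG hd.1 hel (by rw [hE]; exact Finset.subset_union_right)
          (by rw [hE, Finset.insert_union]
              exact Finset.subset_union_left.trans (Finset.subset_insert _ _))]
        rw [contract_loop h] at i5 ⊢
        change Nat.card (Quot (G.curveStep H l.toFinset)) + G.verts.card = _ at i5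
        omega
      · rw [card_curves_contract h hd.1 hel, contract_verts h] at i5
        have := Finset.card_erase_add_one (hG (e, true))
        omega

end Contract

end EmbGraph

/-! ### Paths alternating between two involutions. -/

/-- `AltPath a b T f g`: the path `f, a f, b (a f), a (b (a f)), …` arrives by a step `a` at `g`,
and has not met `T` strictly between `f` and `g`. -/
inductive AltPath {S : Type*} (a b : S → S) (T : Set S) : S → S → Prop
  | start (f : S) : AltPath a b T f (a f)
  | step {f g : S} : AltPath a b T f g → g ∉ T → AltPath a b T f (a (b g))

/-- One step along `a`, or along `b` outside `T`. -/
def segStep {S : Type*} (a b : S → S) (T : Set S) (f g : S) : Prop :=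
  g = a f ∨ (f ∉ T ∧ g = b f)

namespace AltPath

variable {S : Type*} {a b : S → S} {T : Set S}

theorem eq_or_tail {f u : S} (h : AltPath a b T f u) :
    u = a f ∨ (a f ∉ T ∧ AltPath a b T (b (a f)) u) := by
  induction h with
  | start => exact Or.inl rfl
  | step _ hg ih =>
    rcases ih with rfl | ⟨h1, h2⟩
    · exact Or.inr ⟨hg, .start _⟩
    · exact Or.inr ⟨h1, h2.step hg⟩

/-- The path is deterministic and cannot be continued beyond a point of `T`. -/
theorem eq_of_mem {f u g : S} (hu : AltPath a b T f u) (huT : u ∈ T) (hg : AltPath a b T f g)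
    (hgT : g ∈ T) : g = u := by
  have key : ∀ g, AltPath a b T f g → g = u ∨ (g ∉ T ∧ AltPath a b T (b g) u) := by
    intro g hg
    induction hg with
    | start =>
      rcases hu.eq_or_tail with rfl | h
      · exact Or.inl rfl
      · exact Or.inr h
    | step _ hg ih =>
      rcases ih with rfl | ⟨-, h2⟩
      · exact absurd huT hg
      · rcases h2.eq_or_tail with rfl | h
        · exact Or.inl rfl
        · exact Or.inr h
  rcases key g hg with h | ⟨h, -⟩
  · exact h
  · exact absurd hgT h

theorem mk_eq {f g : S} (h : AltPath a b T f g) :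
    Quot.mk (segStep a b T) f = Quot.mk (segStep a b T) g := by
  induction h with
  | start => exact Quot.sound (Or.inl rfl)
  | step _ hg ih =>
    rw [ih]
    exact (Quot.sound (show segStep a b T _ _ from Or.inr ⟨hg, rfl⟩)).trans
      (Quot.sound (Or.inl rfl))

/-- A segment has just two ends: the points visited from `t` on are closed under both involutions,
so they exhaust the class of `t`. -/
theorem eq_or_eq_of_mk_eq (ha : ∀ f, a (a f) = f) (hb : ∀ f, f ∉ T → b f ∉ T ∧ b (b f) = f)
    {t u s : S} (ht : t ∈ T) (hu : u ∈ T) (h : AltPath a b T t u) (hs : s ∈ T)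
    (hts : Quot.mk (segStep a b T) t = Quot.mk (segStep a b T) s) : s = t ∨ s = u := by
  -- All points of the path: its start, the points reached by `a`, and those reached by `b` from
  -- outside `T`.
  let A : S → Prop := fun s =>
    s = t ∨ AltPath a b T t s ∨ ∃ s', AltPath a b T t s' ∧ s' ∉ T ∧ s = b s'
  have hAa : ∀ s, A s → A (a s) := by
    rintro s (rfl | h | ⟨s', h, hs', rfl⟩)
    · exact Or.inr (Or.inl (.start _))
    · cases h with
      | start => exact Or.inl (ha _)
      | @step g h' hg => exact Or.inr (Or.inr ⟨g, h', hg, ha _⟩)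
    · exact Or.inr (Or.inl (h.step hs'))
  have hAb : ∀ s, s ∉ T → A s → A (b s) := by
    rintro s hsT (rfl | h | ⟨s', h, hs', rfl⟩)
    · exact absurd ht hsT
    · exact Or.inr (Or.inr ⟨s, h, hsT, rfl⟩)
    · rw [(hb s' hs').2]
      exact Or.inr (Or.inl h)
  have hA : ∀ f g, segStep a b T f g → (A f ↔ A g) := by
    rintro f g (rfl | ⟨hf, rfl⟩)
    · exact ⟨hAa f, fun h => ha f ▸ hAa _ h⟩
    · exact ⟨hAb f hf, fun h => (hb f hf).2 ▸ hAb _ (hb f hf).1 h⟩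
  rcases (Quot.iff_of_mk_eq hA hts).1 (Or.inl rfl) with h' | h' | ⟨s', -, hs', rfl⟩
  · exact Or.inl h'
  · exact Or.inr (h.eq_of_mem hu h' hs)
  · exact absurd hs (hb s' hs').1

/-- If `T` is enlarged, the path stops at the first new point. -/
theorem exists_first {T' : Set S} {f g : S} (h : AltPath a b T f g) :
    AltPath a b T' f g ∨ ∃ u, u ∈ T' ∧ u ∉ T ∧ AltPath a b T' f u := by
  induction h with
  | start => exact Or.inl (.start _)
  | @step g _ hg ih =>
    rcases ih with ih | ih
    · by_cases hg' : g ∈ T'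
      · exact Or.inr ⟨g, hg', hg, ih⟩
      · exact Or.inl (ih.step hg')
    · exact Or.inr ih

end AltPath

/-- If two relations agree on the points of `P`, then they have the same number of classes inside
`P`. -/
theorem Quot.card_classes_subset {S : Type*} {r r' : S → S → Prop} {P : S → Prop}
    (hr : ∀ f g, r f g → r g f) (hr' : ∀ f g, r' f g → r' g f)
    (h : ∀ f g, P f → (r f g ↔ r' f g)) :
    Nat.card {q : Quot r // ∀ f, Quot.mk r f = q → P f} =
      Nat.card {q : Quot r' // ∀ f, Quot.mk r' f = q → P f} := by
  have key : ∀ {r r' : S → S → Prop}, (∀ f g, r f g → r g f) →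
      (∀ f g, P f → (r f g ↔ r' f g)) → ∀ f, (∀ g, Quot.mk r g = Quot.mk r f → P g) →
      ∀ g, Quot.mk r f = Quot.mk r g → Quot.mk r' f = Quot.mk r' g := by
    intro r r' hr h f hf g hfg
    have step : ∀ g g', r g g' → (Quot.mk r f = Quot.mk r g ∧ Quot.mk r' f = Quot.mk r' g) →
        (Quot.mk r f = Quot.mk r g' ∧ Quot.mk r' f = Quot.mk r' g') := by
      rintro g g' hg ⟨h1, h2⟩
      exact ⟨h1.trans (Quot.sound hg), h2.trans (Quot.sound ((h g g' (hf g h1.symm)).1 hg))⟩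
    exact ((Quot.iff_of_mk_eq (A := fun g => Quot.mk r f = Quot.mk r g ∧
      Quot.mk r' f = Quot.mk r' g)
      (fun g g' hg => ⟨step g g' hg, step g' g (hr _ _ hg)⟩) hfg).1 ⟨rfl, rfl⟩).2
  have key' : ∀ {r r' : S → S → Prop}, (∀ f g, r' f g → r' g f) →
      (∀ f g, P f → (r f g ↔ r' f g)) → ∀ f, (∀ g, Quot.mk r g = Quot.mk r f → P g) →
      ∀ g, Quot.mk r' f = Quot.mk r' g → Quot.mk r f = Quot.mk r g := by
    intro r r' hr' h f hf g hfg
    have step : ∀ g g', r' g g' → Quot.mk r f = Quot.mk r g → Quot.mk r f = Quot.mk r g' := by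
      rintro g g' hg h1
      exact h1.trans (Quot.sound ((h g g' (hf g h1.symm)).2 hg))
    exact (Quot.iff_of_mk_eq (A := fun g => Quot.mk r f = Quot.mk r g)
      (fun g g' hg => ⟨step g g' hg, step g' g (hr' _ _ hg)⟩) hfg).1 rfl
  have pure : ∀ {r r' : S → S → Prop}, (∀ f g, r' f g → r' g f) →
      (∀ f g, P f → (r f g ↔ r' f g)) → ∀ f, (∀ g, Quot.mk r g = Quot.mk r f → P g) →
      (∀ g, Quot.mk r' g = Quot.mk r' f → P g) :=
    fun hr' h f hf g hg => hf g (key' hr' h f hf g hg.symm).symm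
  have h' : ∀ f g, P f → (r' f g ↔ r f g) := fun f g hf => (h f g hf).symm
  have hout : ∀ q : {q : Quot r // ∀ f, Quot.mk r f = q → P f},
      ∀ g, Quot.mk r g = Quot.mk r q.1.out → P g := fun q g hg => q.2 g (hg.trans q.1.out_eq)
  refine Nat.card_eq_of_bijective
    (fun q => ⟨Quot.mk r' q.1.out, pure hr' h q.1.out (hout q)⟩) ⟨?_, ?_⟩
  · intro q q' hqq
    have := key' hr' h _ (hout q) _ (congrArg Subtype.val hqq)
    rw [Quot.out_eq, Quot.out_eq] at this
    exact Subtype.ext this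
  · rintro ⟨q, hq⟩
    induction q using Quot.ind with
    | mk f =>
      have hf := pure hr h' f hq
      refine ⟨⟨Quot.mk r f, hf⟩, Subtype.ext ?_⟩
      exact (key hr h f hf _ (Quot.out_eq (Quot.mk r f)).symm).symm

/-! ### Ribbon graphs arising from relative plane graphs. -/

namespace RibbonGraph

variable {V E E' : Type*} [DecidableEq E]

/-- One step along the boundary of the spanning subgraph with ribbons `F`. -/
def boundaryStep (R : RibbonGraph E') (F : Finset E') (c c' : Corner E') : Prop :=
  c' = R.link c ∨ (c.1 ∈ F ∧ c' = c.along) ∨ (c.1 ∉ F ∧ c' = c.across)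

theorem mk_link (R : RibbonGraph E') (F : Finset E') (c : Corner E') :
    Quot.mk (R.boundaryStep F) (R.link c) = Quot.mk _ c :=
  (Quot.sound (show R.boundaryStep F c _ from Or.inl rfl)).symm

theorem mk_along (R : RibbonGraph E') {F : Finset E'} {c : Corner E'} (hc : c.1 ∈ F) :
    Quot.mk (R.boundaryStep F) c.along = Quot.mk _ c :=
  (Quot.sound (show R.boundaryStep F c _ from Or.inr (Or.inl ⟨hc, rfl⟩))).symm

theorem mk_across (R : RibbonGraph E') {F : Finset E'} {c : Corner E'} (hc : c.1 ∉ F) :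
    Quot.mk (R.boundaryStep F) c.across = Quot.mk _ c :=
  (Quot.sound (show R.boundaryStep F c _ from Or.inr (Or.inr ⟨hc, rfl⟩))).symm

/-- Cut at the sides of regular edges, the curves fall into medial arcs, and each arc that meets a
regular edge has exactly the ends `φ c` and `φ (R.link c)`. Curves inside the 0-edges have no corner
and are excluded here. -/
theorem card_boundary_of_arc [DecidableEq E'] (R : RibbonGraph E') (G : EmbGraph V E) (H F : Finset E)
    (F' : Finset E') (φ : Corner E' → DartSide E) (hφ : Function.Injective φ)
    (hrange : ∀ f, (∃ c, φ c = f) ↔ f.1.1 ∉ H)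
    (hacross : ∀ c, φ c.across = ((φ c).1, !(φ c).2))
    (halong : ∀ c, φ c.along = ((φ c).1.flip, !(φ c).2))
    (hlink : ∀ c, AltPath G.corner (EmbGraph.continuation H ∅) {f | f.1.1 ∉ H} (φ c) (φ (R.link c)))
    (hF : ∀ c : Corner E', c.1 ∈ F' ↔ (φ c).1.1 ∈ F) :
    Nat.card (Quot (R.boundaryStep F')) =
      Nat.card {q : Quot (G.curveStep H F) // ¬ ∀ f, Quot.mk _ f = q → f.1.1 ∈ H} := by
  have hT : ∀ c, (φ c).1.1 ∉ H := fun c => (hrange _).1 ⟨c, rfl⟩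
  have hseg : ∀ f g, segStep G.corner (EmbGraph.continuation H ∅) {f | f.1.1 ∉ H} f g →
      G.curveStep H F f g := by
    rintro f g (rfl | ⟨hf, rfl⟩)
    · exact Or.inl rfl
    · have : f.1.1 ∈ H := by simpa using hf
      exact Or.inr (by simp [EmbGraph.continuation, this])
  have hb : ∀ f : DartSide E, f ∉ {f : DartSide E | f.1.1 ∉ H} →
      EmbGraph.continuation H ∅ f ∉ {f : DartSide E | f.1.1 ∉ H} ∧
      EmbGraph.continuation H ∅ (EmbGraph.continuation H ∅ f) = f := fun f hf =>
    ⟨by rw [Set.mem_ofPred_eq, EmbGraph.continuation_fst]; exact hf,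
      EmbGraph.continuation_continuation _ _ _⟩
  have hends : ∀ c c', Quot.mk (segStep G.corner (EmbGraph.continuation H ∅) {f | f.1.1 ∉ H})
      (φ c) = Quot.mk _ (φ c') → c' = c ∨ c' = R.link c := by
    intro c c' h
    rcases AltPath.eq_or_eq_of_mk_eq G.corner_corner hb (hT c) (hT _) (hlink c) (hT c') h with h | h
    · exact Or.inl (hφ h)
    · exact Or.inr (hφ h)
  have hcont : ∀ c, EmbGraph.continuation H F (φ c) =
      if c.1 ∈ F' then φ c.along else φ c.across := by
    intro c
    by_cases h : c.1 ∈ F'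
    · simp [EmbGraph.continuation, hT c, h, (hF c).1 h, halong]
    · simp [EmbGraph.continuation, hT c, h, mt (hF c).2 h, hacross]
  let Φ : Quot (R.boundaryStep F') → Quot (G.curveStep H F) :=
    Quot.lift (fun c => Quot.mk _ (φ c)) (by
      rintro c c' (rfl | ⟨hc, rfl⟩ | ⟨hc, rfl⟩)
      · exact congrArg (Quot.map id hseg) (hlink c).mk_eq
      · have := hcont c
        rw [if_pos hc] at this
        rw [← this]
        exact (EmbGraph.mk_continuation G H F _).symm
      · have := hcont c
        rw [if_neg hc] at this
        rw [← this]
        exact (EmbGraph.mk_continuation G H F _).symm)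
  refine Nat.card_eq_of_bijective (fun q => ⟨Φ q, ?_⟩) ⟨?_, ?_⟩
  · induction q using Quot.ind with
    | mk c => exact fun h => hT c (h _ rfl)
  · intro q q' h
    replace h : Φ q = Φ q' := congrArg Subtype.val h
    induction q using Quot.ind with
    | mk c =>
    induction q' using Quot.ind with
    | mk c' =>
    -- The sides on arcs whose corners lie on the boundary component of `c`. This set is closed
    -- under `curveStep`, which gives injectivity.
    let A : DartSide E → Prop := fun f => ∃ c₁, Quot.mk (R.boundaryStep F') c₁ = Quot.mk _ c ∧
      Quot.mk (segStep G.corner (EmbGraph.continuation H ∅) {f | f.1.1 ∉ H}) f = Quot.mk _ (φ c₁)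
    have hmk : ∀ c₁ c₂, Quot.mk (R.boundaryStep F') c₁ = Quot.mk _ c →
        Quot.mk (segStep G.corner (EmbGraph.continuation H ∅) {f | f.1.1 ∉ H}) (φ c₂) =
          Quot.mk _ (φ c₁) → Quot.mk (R.boundaryStep F') c₂ = Quot.mk _ c := by
      intro c₁ c₂ h1 h2
      rcases hends _ _ h2.symm with rfl | rfl
      · exact h1
      · exact (R.mk_link F' c₁).trans h1
    have hA : ∀ f g, G.curveStep H F f g → A f → A g := by
      rintro f g hfg ⟨c₁, h1, h2⟩
      by_cases hf : f.1.1 ∈ H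
      · refine ⟨c₁, h1, Eq.trans (Quot.sound ?_).symm h2⟩
        rcases hfg with rfl | rfl
        · exact Or.inl rfl
        · exact Or.inr ⟨by simpa using hf, by simp [EmbGraph.continuation, hf]⟩
      · rcases hfg with rfl | rfl
        · exact ⟨c₁, h1, (AltPath.start f).mk_eq.symm.trans h2⟩
        · obtain ⟨c₂, rfl⟩ := (hrange f).2 hf
          have h3 := hmk c₁ c₂ h1 h2
          rw [hcont]
          split_ifs with hc
          · exact ⟨c₂.along, (R.mk_along hc).trans h3, rfl⟩
          · exact ⟨c₂.across, (R.mk_across hc).trans h3, rfl⟩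
    obtain ⟨c₁, h1, h2⟩ := (Quot.iff_of_mk_eq (fun f g hfg =>
      ⟨hA f g hfg, hA g f (EmbGraph.curveStep_symm hfg)⟩) h).1 (⟨c, rfl, rfl⟩ : A (φ c))
    exact (hmk c₁ c' h1 h2).symm
  · rintro ⟨q, hq⟩
    push Not at hq
    obtain ⟨f, rfl, hf⟩ := hq
    obtain ⟨c, rfl⟩ := (hrange f).2 hf
    exact ⟨Quot.mk _ c, rfl⟩

theorem altPath_of_arc {V E : Type*} [DecidableEq E] {G : EmbGraph V E} {H : Finset E} {f g : DartSide E} (h : G.Arc H f g) :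
    AltPath G.corner (EmbGraph.continuation H ∅) {f | f.1.1 ∉ H} f g := by
  induction h with
  | start => exact .start _
  | @cross g _ hg ih =>
    have := ih.step (by simpa using hg)
    have h' : EmbGraph.continuation H ∅ g = (g.1.flip, g.2) := if_pos hg
    rwa [h'] at this

/-- Curves that meet a regular edge are counted by `card_boundary_of_arc`. The others do not depend
on `F`, so they are the circles without arrows counted in `isolated`. -/
theorem boundary_of_arisesFrom [Fintype V] [Fintype E] [DecidableEq E'] {R : RibbonGraph E'} {G : RelPlaneGraph V E}
    {ε : E' ≃ {e : E // e ∉ G.zeroEdges}} (h : R.ArisesFrom G ε) {F : Finset E} {F' : Finset E'}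
    (hF : ∀ e, e ∈ F' ↔ (ε e).1 ∈ F) :
    R.boundary F' = Nat.card (Quot (G.emb.curveStep G.zeroEdges F)) + G.emb.bare := by
  classical
  obtain ⟨φ, h1, h2, h3, h4, h5⟩ := h
  -- On each ribbon `φ` is determined by one corner. The term `b ^^ s` appears because a free side
  -- of the ribbon changes its name between left and right at the other end.
  have hval : ∀ e, ∃ b₀ s₀, ∀ b s, φ (e, b, s) = (((ε e).1, b ^^ b₀), (b ^^ s) ^^ s₀) := by
    intro e
    have ha := h2 (e, false, false)
    have hl := h3 (e, false, false)
    have hla := h3 (e, false, true)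
    simp only [Corner.across, Corner.along, Bool.not_false] at ha hl hla
    rw [ha] at hla
    refine ⟨(φ (e, false, false)).1.2, (φ (e, false, false)).2, ?_⟩
    have h0 : φ (e, false, false) = (((ε e).1, (φ (e, false, false)).1.2),
        (φ (e, false, false)).2) := by rw [← h1 (e, false, false)]
    generalize hp : φ (e, false, false) = p at h0 ha hl hla ⊢
    rw [h0] at ha hl hla hp
    rintro (_ | _) (_ | _)
    · simpa using hp
    · simpa using ha
    · simpa [Dart.flip] using hl
    · simpa [Dart.flip] using hla
  have hinj : Function.Injective φ := by
    rintro ⟨e, b, s⟩ ⟨e', b', s'⟩ h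
    obtain rfl : e = e' := by
      have := congrArg (fun f => f.1.1) h
      simp only [h1] at this
      exact ε.injective (Subtype.ext this)
    obtain ⟨b₀, s₀, he⟩ := hval e
    rw [he, he] at h
    simp only [Prod.mk.injEq, true_and, Bool.xor_left_inj] at h
    obtain ⟨rfl, h⟩ := h
    simpa using h
  have hrange : ∀ f, (∃ c, φ c = f) ↔ f.1.1 ∉ G.zeroEdges := by
    intro f
    constructor
    · rintro ⟨c, rfl⟩
      rw [h1]
      exact (ε c.1).2
    · intro hf
      obtain ⟨⟨e, b⟩, s⟩ := f
      obtain ⟨e', he'⟩ := ε.surjective ⟨e, hf⟩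
      obtain ⟨b₀, s₀, hv⟩ := hval e'
      refine ⟨(e', b ^^ b₀, (b ^^ b₀) ^^ (s ^^ s₀)), ?_⟩
      rw [hv, he']
      cases b <;> cases b₀ <;> simp
  have hc := card_boundary_of_arc R G.emb G.zeroEdges F F' φ hinj hrange h2 h3
    (fun c => altPath_of_arc (h4 c)) (fun c => by rw [h1, hF])
  have hp := Quot.card_classes_subset (r := G.emb.curveStep G.zeroEdges F)
    (r' := G.emb.curveStep G.zeroEdges ∅) (P := fun f => f.1.1 ∈ G.zeroEdges)
    (fun _ _ => EmbGraph.curveStep_symm) (fun _ _ => EmbGraph.curveStep_symm)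
    (fun f g hf => by simp [EmbGraph.curveStep, EmbGraph.continuation, hf])
  rw [← EmbGraph.curveStep_empty, ← hp] at h5
  have hsum := Nat.card_congr (Equiv.sumCompl fun q : Quot (G.emb.curveStep G.zeroEdges F) =>
    ∀ f, Quot.mk _ f = q → f.1.1 ∈ G.zeroEdges)
  rw [Nat.card_sum] at hsum
  have hb : R.boundary F' = Nat.card (Quot (R.boundaryStep F')) + R.isolated := rfl
  omega

end RibbonGraph

/-! ### Tracing ribbons in a plane picture. -/

theorem AltPath.mono {S : Type*} {a b : S → S} {T T' : Set S} (hT : T ⊆ T') {f g : S}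
    (h : AltPath a b T' f g) : AltPath a b T f g := by
  induction h with
  | start => exact .start _
  | step _ hg ih => exact ih.step fun h' => hg (hT h')

theorem AltPath.map {S : Type*} {a b σ : S → S} {T : Set S} (ha : ∀ f, a (σ f) = σ (a f))
    (hb : ∀ f, b (σ f) = σ (b f)) (hT : ∀ f, σ f ∈ T → f ∈ T) {f g : S}
    (h : AltPath a b T f g) : AltPath a b T (σ f) (σ g) := by
  induction h with
  | start => rw [← ha]; exact .start _
  | step _ hg ih =>
    rw [← ha, ← hb]
    exact ih.step fun h' => hg (hT _ h')

/-- The other side of the same dart. -/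
def DartSide.swap {E : Type*} (f : DartSide E) : DartSide E := (f.1, !f.2)

/-- The same side of the edge, seen from the other end. -/
def DartSide.opposite {E : Type*} (f : DartSide E) : DartSide E := (f.1.flip, !f.2)

theorem DartSide.opposite_opposite {E : Type*} (f : DartSide E) : f.opposite.opposite = f := by
  simp [opposite, Dart.flip_flip]

theorem DartSide.opposite_swap {E : Type*} (f : DartSide E) :
    f.swap.opposite = f.opposite.swap := rfl

theorem DartSide.swap_swap {E : Type*} (f : DartSide E) : f.swap.swap = f := by
  simp [swap]

theorem DartSide.eq_of_edge_eq {E : Type*} {f g : DartSide E} (h : f.1.1 = g.1.1) :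
    f = g ∨ f = g.swap ∨ f = g.opposite ∨ f = g.opposite.swap := by
  obtain ⟨⟨e, b⟩, s⟩ := f
  obtain ⟨⟨e', b'⟩, s'⟩ := g
  simp only at h
  subst h
  cases b <;> cases b' <;> cases s <;> cases s' <;>
    simp [DartSide.swap, DartSide.opposite, Dart.flip]

theorem Corner.along_along {E : Type*} (c : Corner E) : c.along.along = c := by
  simp [along]

theorem Corner.along_ne {E : Type*} (c : Corner E) : c.along ≠ c := by
  intro h
  simpa [along] using congrArg (fun c => c.2.1) h

theorem Corner.along_across_ne {E : Type*} (c : Corner E) : c.along.across ≠ c := by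
  intro h
  simpa [along, across] using congrArg (fun c => c.2.1) h

theorem Corner.along_ne_across {E : Type*} (c : Corner E) : c.along ≠ c.across := by
  intro h
  simpa [along, across] using congrArg (fun c => c.2.1) h

theorem Corner.across_ne {E : Type*} (c : Corner E) : c.across ≠ c := by
  intro h
  simpa [across] using congrArg (fun c => c.2.2) h

namespace RibbonPicture

variable {N A : Type*} [Fintype N] [Fintype A]

section Pass

variable (D : RibbonPicture N A) {f : DartSide A}

theorem pass_disc (h : D.kind (D.tail f.1) = .disc) : D.pass f = f := by
  simp only [pass, h]

theorem pass_regular (h : D.kind (D.tail f.1) = .regular) : D.pass f = (D.rot f.1, !f.2) := by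
  simp only [pass, h]

theorem pass_twist (h : D.kind (D.tail f.1) = .twist) : D.pass f = (D.rot f.1, f.2) := by
  simp only [pass, h]

theorem pass_crossing (h : D.kind (D.tail f.1) = .crossing) :
    D.pass f = (D.rot (D.rot f.1), !f.2) := by
  simp only [pass, h]

theorem tail_pass (f : DartSide A) : D.tail (D.pass f).1 = D.tail f.1 := by
  rcases h : D.kind (D.tail f.1)
  · rw [D.pass_disc h]
  · rw [D.pass_regular h, D.tail_rot]
  · rw [D.pass_twist h, D.tail_rot]
  · rw [D.pass_crossing h, D.tail_rot, D.tail_rot]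

theorem pass_pass (f : DartSide A) : D.pass (D.pass f) = f := by
  rcases h : D.kind (D.tail f.1)
  · rw [D.pass_disc h, D.pass_disc h]
  · have h' := D.tail_pass f
    rw [D.pass_regular (by rw [h', h]), D.pass_regular h]
    simp [(D.regular_deg _ h).2]
  · have h' := D.tail_pass f
    rw [D.pass_twist (by rw [h', h]), D.pass_twist h]
    simp [(D.twist_deg _ h).2]
  · have h' := D.tail_pass f
    rw [D.pass_crossing (by rw [h', h]), D.pass_crossing h]
    simp [(D.crossing_deg _ h).2]

theorem pass_swap (f : DartSide A) : D.pass f.swap = (D.pass f).swap := by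
  have ht : D.tail f.swap.1 = D.tail f.1 := rfl
  rcases h : D.kind (D.tail f.1)
  · rw [D.pass_disc h, D.pass_disc (by rw [ht, h])]
  · rw [D.pass_regular h, D.pass_regular (by rw [ht, h])]; rfl
  · rw [D.pass_twist h, D.pass_twist (by rw [ht, h])]; rfl
  · rw [D.pass_crossing h, D.pass_crossing (by rw [ht, h])]; rfl

/-- The sides of the darts at the vertex-discs. -/
def discSides : Set (DartSide A) := {f | D.kind (D.tail f.1) = .disc}

/-- The sides of the darts at the vertex-discs and at the regular portions. -/
def markedSides : Set (DartSide A) :=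
  {f | D.kind (D.tail f.1) = .disc ∨ D.kind (D.tail f.1) = .regular}

theorem discSides_subset : D.discSides ⊆ D.markedSides := fun _ h => Or.inl h

theorem altPath_of_line {D : RibbonPicture N A} {f g : DartSide A} (h : D.Line f g) :
    AltPath DartSide.opposite D.pass D.discSides f g := by
  induction h with
  | start => exact .start _
  | step _ hg ih => exact ih.step hg

theorem line_of_altPath {D : RibbonPicture N A} {f g : DartSide A}
    (h : AltPath DartSide.opposite D.pass D.discSides f g) : D.Line f g := by
  induction h with
  | start => exact .start _
  | step _ hg ih => exact ih.step hg

theorem pass_disc_iff (f : DartSide A) : D.pass f ∈ D.discSides ↔ f ∈ D.discSides := by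
  change D.kind _ = _ ↔ D.kind _ = _
  rw [tail_pass]

theorem pass_marked_iff (f : DartSide A) : D.pass f ∈ D.markedSides ↔ f ∈ D.markedSides := by
  change D.kind _ = _ ∨ D.kind _ = _ ↔ D.kind _ = _ ∨ D.kind _ = _
  rw [tail_pass]

end Pass

theorem eq_or_eq_rot (D : RibbonPicture N A) {d d' : Dart A} (h : D.rot (D.rot d) = d)
    (hd : D.tail d' = D.tail d) : d' = d ∨ d' = D.rot d := by
  obtain ⟨n, -, rfl⟩ := ((D.sameCycle_iff d d').2 hd.symm).exists_pow_eq'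
  induction n with
  | zero => exact Or.inl rfl
  | succ k ih =>
    rw [pow_succ', Equiv.Perm.mul_apply]
    have ht : D.tail ((D.rot ^ k) d) = D.tail d := by
      rw [pow_succ', Equiv.Perm.mul_apply, D.tail_rot] at hd
      exact hd
    rcases ih ht with h' | h'
    · rw [h']; exact Or.inr rfl
    · rw [h', h]; exact Or.inl rfl

/-- Every side of a portion of a ribbon is connected, without passing a regular portion, to
exactly one corner. -/
theorem IsProjection.exists_owner {E : Type*} {D : RibbonPicture N A} {R : RibbonGraph E}
    {φ : Corner E → DartSide A} (h : D.IsProjection R φ) :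
    ∃ o : DartSide A → Corner E, (∀ c, o (φ c) = c) ∧
      (∀ f, Quot.mk (segStep DartSide.opposite D.pass D.markedSides) f = Quot.mk _ (φ (o f))) ∧
      (∀ f g, Quot.mk (segStep DartSide.opposite D.pass D.markedSides) f = Quot.mk _ g →
        o f = o g) ∧
      (∀ f, o f.swap = (o f).across) ∧
      (∀ f, D.kind (D.tail f.1) = .regular → o (D.pass f) = (o f).along) ∧
      (∀ c, ∃ f, D.kind (D.tail f.1) = .regular ∧ o f = c) := by
  have hdisc : ∀ c, D.kind (D.tail (φ c).1) = .disc := fun c => (h.range_iff _).1 ⟨c, rfl⟩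
  have hend : ∀ {c c'}, Quot.mk (segStep DartSide.opposite D.pass D.discSides) (φ c) =
      Quot.mk _ (φ c') → c' = c ∨ c' = c.along := by
    intro c c' hcc
    rcases AltPath.eq_or_eq_of_mk_eq DartSide.opposite_opposite
      (fun f hf => ⟨fun hf' => hf ((D.pass_disc_iff f).1 hf'), D.pass_pass f⟩) (hdisc c) (hdisc _)
      (altPath_of_line (h.along c)) (hdisc c') hcc with h1 | h1
    · exact Or.inl (h.injective h1)
    · exact Or.inr (h.injective h1)
  have hend' : ∀ {t u s : DartSide A}, t ∈ D.markedSides → u ∈ D.markedSides →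
      AltPath DartSide.opposite D.pass D.markedSides t u → s ∈ D.markedSides →
      Quot.mk (segStep DartSide.opposite D.pass D.markedSides) t = Quot.mk _ s →
      s = t ∨ s = u := fun ht hu htu hs hts =>
    AltPath.eq_or_eq_of_mk_eq DartSide.opposite_opposite
      (fun f hf => ⟨fun hf' => hf ((D.pass_marked_iff f).1 hf'), D.pass_pass f⟩) ht hu htu hs hts
  have hswap : ∀ {f g : DartSide A}, AltPath DartSide.opposite D.pass D.markedSides f g →
      AltPath DartSide.opposite D.pass D.markedSides f.swap g.swap := fun hfg =>
    hfg.map DartSide.opposite_swap D.pass_swap fun _ hf => hf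
  have hfirst : ∀ {c f}, D.Line (φ c) f → AltPath DartSide.opposite D.pass D.markedSides (φ c) f ∨
      ∃ u : DartSide A, D.kind (D.tail u.1) = .regular ∧
        AltPath DartSide.opposite D.pass D.markedSides (φ c) u := by
    intro c f hf
    rcases (altPath_of_line hf).exists_first (T' := D.markedSides) with h1 | ⟨u, h1, h2, h3⟩
    · exact Or.inl h1
    · exact Or.inr ⟨u, h1.resolve_left h2, h3⟩
  have hacross : ∀ c, (∃ u : DartSide A, D.kind (D.tail u.1) = .regular ∧
      AltPath DartSide.opposite D.pass D.markedSides (φ c) u) →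
      ∃ u : DartSide A, D.kind (D.tail u.1) = .regular ∧
        AltPath DartSide.opposite D.pass D.markedSides (φ c.across) u := by
    rintro c ⟨u, h1, h2⟩
    refine ⟨u.swap, h1, ?_⟩
    rw [h.across]
    exact hswap h2
  have hne : ∀ {c : Corner E} {u : DartSide A}, D.kind (D.tail u.1) = .regular → φ c ≠ u := by
    rintro c u h1 rfl
    rw [hdisc] at h1
    cases h1
  -- If the line from `c.along` back to `c` met no regular portion, both corners would be ends of
  -- one segment, whose ends are already `φ c` and `u`.
  have halong : ∀ c, (∃ u : DartSide A, D.kind (D.tail u.1) = .regular ∧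
      AltPath DartSide.opposite D.pass D.markedSides (φ c) u) →
      ∃ u : DartSide A, D.kind (D.tail u.1) = .regular ∧
        AltPath DartSide.opposite D.pass D.markedSides (φ c.along) u := by
    rintro c ⟨u, h1, h2⟩
    have hl := h.along c.along
    rw [c.along_along] at hl
    rcases hfirst hl with h3 | h3
    · rcases hend' (Or.inl (hdisc c)) (Or.inr h1) h2 (Or.inl (hdisc c.along)) h3.mk_eq.symm
        with h4 | h4
      · exact absurd (h.injective h4) c.along_ne
      · exact absurd h4 (hne h1)
    · exact h3
  have hreg : ∀ c, ∃ u : DartSide A, D.kind (D.tail u.1) = .regular ∧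
      AltPath DartSide.opposite D.pass D.markedSides (φ c) u := by
    rintro ⟨e, b', s'⟩
    obtain ⟨n, ⟨hn, b, s, f, hf, rfl⟩, -⟩ := h.regular e
    have h0 : ∃ u : DartSide A, D.kind (D.tail u.1) = .regular ∧
        AltPath DartSide.opposite D.pass D.markedSides (φ (e, b, s)) u := by
      rcases hfirst hf with h1 | h1
      · exact ⟨f, hn, h1⟩
      · exact h1
    have h1 : ∃ u : DartSide A, D.kind (D.tail u.1) = .regular ∧
        AltPath DartSide.opposite D.pass D.markedSides (φ (e, b', s)) u := by
      rcases Bool.eq_or_eq_not b' b with rfl | rfl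
      · exact h0
      · exact halong _ h0
    rcases Bool.eq_or_eq_not s' s with rfl | rfl
    · exact h1
    · exact hacross _ h1
  -- `ρ c` is the side at which the line from `c` first reaches the regular portion. So each segment
  -- between marked sides that contains a corner has one disc end and one regular end.
  choose ρ hρ hρpath using hreg
  have hinj : ∀ {c c'}, Quot.mk (segStep DartSide.opposite D.pass D.markedSides) (φ c) =
      Quot.mk _ (φ c') → c = c' := by
    intro c c' hcc
    rcases hend' (Or.inl (hdisc c)) (Or.inr (hρ c)) (hρpath c) (Or.inl (hdisc c')) hcc with h1 | h1
    · exact (h.injective h1).symm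
    · exact absurd h1 (hne (hρ c))
  have hρeq : ∀ {c u}, D.kind (D.tail u.1) = .regular →
      Quot.mk (segStep DartSide.opposite D.pass D.markedSides) (φ c) = Quot.mk _ u → u = ρ c := by
    intro c u hu hcu
    rcases hend' (Or.inl (hdisc c)) (Or.inr (hρ c)) (hρpath c) (Or.inr hu) hcu with h1 | h1
    · exact absurd h1.symm (hne hu)
    · exact h1
  have hρinj : ∀ {c c'}, ρ c = ρ c' → c = c' := by
    intro c c' hcc
    refine hinj ((hρpath c).mk_eq.trans ?_)
    rw [hcc]
    exact (hρpath c').mk_eq.symm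
  have hline : ∀ c, D.Line (φ c) (ρ c) := fun c =>
    line_of_altPath ((hρpath c).mono D.discSides_subset)
  have hρacross : ∀ c, ρ c.across = (ρ c).swap := by
    intro c
    symm
    refine hρeq (hρ c) ?_
    rw [h.across]
    exact (hswap (hρpath c)).mk_eq
  -- The ribbon has only one regular portion, so both lines arrive at the same node of degree two.
  -- The wrong dart contradicts injectivity of `ρ`; the wrong side would give the line from `c` a
  -- third corner, `c.along.across`.
  have hρalong : ∀ c, ρ c.along = D.pass (ρ c) := by
    intro c
    have htail : D.tail (ρ c.along).1 = D.tail (ρ c).1 := by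
      obtain ⟨n, -, hn⟩ := h.regular c.1
      rw [hn _ ⟨hρ c, c.2.1, c.2.2, _, hline c, rfl⟩]
      exact hn _ ⟨hρ c.along, _, _, _, hline c.along, rfl⟩
    have hcases : ∀ {f g : DartSide A}, f.1 = g.1 → f = g ∨ f = g.swap := by
      rintro ⟨d, s⟩ ⟨d', s'⟩ rfl
      rcases Bool.eq_or_eq_not s s' with rfl | rfl
      · exact Or.inl rfl
      · exact Or.inr rfl
    rcases D.eq_or_eq_rot (D.regular_deg _ (hρ c)).2 htail with h1 | h1
    · rcases hcases h1 with h2 | h2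
      · exact absurd (hρinj h2) c.along_ne
      · rw [← hρacross] at h2
        exact absurd (hρinj h2) c.along_ne_across
    · have h2 : (ρ c.along).1 = (D.pass (ρ c)).1 := by
        rw [h1, D.pass_regular (hρ c)]
      rcases hcases h2 with h3 | h3
      · exact h3
      · exfalso
        have h4 : D.pass (ρ c) = ρ c.along.across := by
          rw [hρacross, h3, DartSide.swap_swap]
        have h5 : Quot.mk (segStep DartSide.opposite D.pass D.discSides) (ρ c) =
            Quot.mk _ (D.pass (ρ c)) := by
          refine Quot.sound (Or.inr ⟨fun h' => ?_, rfl⟩)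
          have h' : D.kind (D.tail (ρ c).1) = .disc := h'
          rw [hρ] at h'
          cases h'
        rw [h4] at h5
        rcases hend ((altPath_of_line (hline c)).mk_eq.trans
          (h5.trans (altPath_of_line (hline _)).mk_eq.symm)) with h6 | h6
        · exact c.along_across_ne h6
        · exact c.along.across_ne h6
  have hmkswap : ∀ {f g : DartSide A},
      Quot.mk (segStep DartSide.opposite D.pass D.markedSides) f = Quot.mk _ g →
      Quot.mk (segStep DartSide.opposite D.pass D.markedSides) f.swap = Quot.mk _ g.swap := by
    intro f g hfg
    refine congrArg (Quot.map DartSide.swap ?_) hfg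
    rintro f g (rfl | ⟨hf, rfl⟩)
    · exact Or.inl rfl
    · exact Or.inr ⟨hf, (D.pass_swap f).symm⟩
  have hswapo : ∀ f c, Quot.mk (segStep DartSide.opposite D.pass D.markedSides) f =
      Quot.mk _ (φ c) → Quot.mk (segStep DartSide.opposite D.pass D.markedSides) f.swap =
      Quot.mk _ (φ c.across) := by
    intro f c hfc
    rw [h.across]
    exact hmkswap hfc
  have hpasso : ∀ f c, D.kind (D.tail f.1) = .regular →
      Quot.mk (segStep DartSide.opposite D.pass D.markedSides) f = Quot.mk _ (φ c) →
      Quot.mk (segStep DartSide.opposite D.pass D.markedSides) (D.pass f) =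
        Quot.mk _ (φ c.along) := by
    intro f c hf hfc
    rw [hρeq hf hfc.symm, ← hρalong]
    exact (hρpath c.along).mk_eq.symm
  have hopp : ∀ f : DartSide A, Quot.mk (segStep DartSide.opposite D.pass D.markedSides)
      f.opposite = Quot.mk _ f := fun f => (AltPath.start f).mk_eq.symm
  have hex : ∀ f, ∃ c, Quot.mk (segStep DartSide.opposite D.pass D.markedSides) f =
      Quot.mk _ (φ c) := by
    intro f
    obtain ⟨c, f₀, hf₀, hff⟩ := h.covered f.1.1
    have h0 : ∃ c, Quot.mk (segStep DartSide.opposite D.pass D.markedSides) f₀ =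
        Quot.mk _ (φ c) := by
      clear hff
      induction hf₀ with
      | start => exact ⟨c, hopp _⟩
      -- The owner changes to the corner along the ribbon when the line passes the regular portion,
      -- and is kept at twists and crossings.
      | @step g _ hg ih =>
        obtain ⟨c', hc'⟩ := ih
        by_cases hr : D.kind (D.tail g.1) = .regular
        · exact ⟨_, (hopp _).trans (hpasso g c' hr hc')⟩
        · refine ⟨c', (hopp _).trans (Eq.trans (Quot.sound ?_).symm hc')⟩
          exact Or.inr ⟨fun h' => h'.elim hg hr, rfl⟩
    obtain ⟨c', hc'⟩ := h0
    rcases DartSide.eq_of_edge_eq hff.symm with rfl | rfl | rfl | rfl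
    · exact ⟨c', hc'⟩
    · exact ⟨_, hswapo _ _ hc'⟩
    · exact ⟨c', (hopp _).trans hc'⟩
    · exact ⟨_, hswapo _ _ ((hopp _).trans hc')⟩
  choose o ho using hex
  refine ⟨o, fun c => (hinj (ho (φ c))).symm, ho, fun f g hfg => ?_, fun f => ?_, fun f hf => ?_,
    fun c => ⟨ρ c, hρ c, ?_⟩⟩
  · exact hinj ((ho f).symm.trans (hfg.trans (ho g)))
  · exact hinj ((ho _).symm.trans (hswapo f _ (ho f)))
  · exact hinj ((ho _).symm.trans (hpasso f _ hf (ho f)))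
  · exact hinj ((ho _).symm.trans (hρpath c).mk_eq.symm)

end RibbonPicture

/-! ### The boundary of a projected ribbon graph. -/

namespace RibbonPicture

variable {N A : Type*} [Fintype N] [Fintype A] (D : RibbonPicture N A)

theorem endMate_crossing_false {y : Dart A} (h : D.kind (D.tail y) = .crossing) :
    D.endMate (y, false) = (D.rot y, true) := by
  simp only [endMate, h]

theorem endMate_of_ne_crossing {y : Dart A} {t : Bool} (h : D.kind (D.tail y) ≠ .crossing) :
    D.endMate (y, t) = (D.rot y, false) := by
  rcases h' : D.kind (D.tail y) <;> simp_all [endMate]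

theorem endRot_crossing_false {y : Dart A} (h : D.kind (D.tail y) = .crossing) :
    D.endRot (y, false) = (y, true) := by
  simp only [endRot, h]

theorem endRot_true (y : Dart A) : D.endRot (y, true) = (D.nextEnd y, false) := by
  rcases h' : D.kind (D.tail y) <;> simp [endRot, h']

theorem endRot_of_ne_crossing {y : Dart A} {t : Bool} (h : D.kind (D.tail y) ≠ .crossing) :
    D.endRot (y, t) = (D.nextEnd y, false) := by
  rcases h' : D.kind (D.tail y) <;> simp_all [endRot]

theorem nextEnd_disc {y : Dart A} (h : D.kind (D.tail y.flip) = .disc) :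
    D.nextEnd y = (D.rot y.flip).flip := by
  simp only [nextEnd, h]

theorem nextEnd_of_ne_disc {y : Dart A} (h : D.kind (D.tail y.flip) ≠ .disc) :
    D.nextEnd y = y.flip := by
  rcases h' : D.kind (D.tail y.flip) <;> simp_all [nextEnd]

/-- The curves in the picture run along the boundary of the projected ribbons. Each side of a dart
of `G` is sent to the corner owning the ribbon side that runs there, each corner to the curve near
it, and these maps are inverse on classes. -/
theorem boundary_of_isProjection {V E E' : Type*} [Fintype V] [Fintype E] [DecidableEq E]
    {D : RibbonPicture N A} {R : RibbonGraph E'} {φ : Corner E' → DartSide A}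
    (hD : D.IsProjection R φ) {G : RelPlaneGraph V E} {ψ : Dart E → Dart A × Bool}
    (hG : D.IsRelPlaneGraph G ψ) {ε : E' ≃ {e : E // e ∉ G.zeroEdges}}
    (hε : ∀ (e : E') (b : Bool), ∃ b' s f,
      D.Line (φ (e, b', s)) f ∧ f.1 = (ψ ((ε e).1, b)).1)
    {F : Finset E} {F' : Finset E'} (hF : ∀ e, e ∈ F' ↔ (ε e).1 ∈ F) :
    R.boundary F' = Nat.card (Quot (G.emb.curveStep G.zeroEdges F)) + G.emb.bare := by
  classical
  obtain ⟨o, ho, homk, hoeq, hoswap, hopass, hoex⟩ := hD.exists_owner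
  have hdisc : ∀ c, D.kind (D.tail (φ c).1) = .disc := fun c => (hD.range_iff _).1 ⟨c, rfl⟩
  have hoopp : ∀ f : DartSide A, o f.opposite = o f := fun f =>
    hoeq _ _ (AltPath.start f).mk_eq.symm
  have hopass' : ∀ f : DartSide A, D.kind (D.tail f.1) ≠ .disc → D.kind (D.tail f.1) ≠ .regular →
      o (D.pass f) = o f := fun f h1 h2 =>
    (hoeq _ _ (Quot.sound (Or.inr ⟨fun h => h.elim h1 h2, rfl⟩))).symm
  -- The two ends of a portion side have the same owner, whereas different corners own themselves;
  -- so no portion runs from disc to disc.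
  have hflip : ∀ y : Dart A, D.kind (D.tail y) = .disc → D.kind (D.tail y.flip) ≠ .disc := by
    intro y h1 h2
    obtain ⟨c, hc⟩ := (hD.range_iff (y, true)).2 h1
    obtain ⟨c', hc'⟩ := (hD.range_iff (DartSide.opposite (y, true))).2 h2
    have h3 := hoopp (y, true)
    rw [← hc', ← hc, ho, ho] at h3
    subst h3
    exact Dart.flip_ne y (congrArg Prod.fst (hc'.symm.trans hc))
  -- the edge of `G` and the ribbon at a regular portion
  have holine : ∀ {c f}, D.Line (φ c) f → (o f).1 = c.1 := by
    intro c f h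
    induction h with
    | start => exact congrArg Prod.fst ((hoopp _).trans (ho c))
    | @step g _ hg ih =>
      have h1 : o ((D.pass g).1.flip, !(D.pass g).2) = o (D.pass g) := hoopp (D.pass g)
      rw [h1]
      by_cases hr : D.kind (D.tail g.1) = .regular
      · rw [hopass g hr]; exact ih
      · rw [hopass' g hg hr]; exact ih
  have hofst : ∀ (y : Dart A) (s s' : Bool), (o (y, s)).1 = (o (y, s')).1 := by
    intro y s s'
    rcases Bool.eq_or_eq_not s s' with rfl | rfl
    · rfl
    · rw [show o (y, !s') = (o (y, s')).across from hoswap (y, s')]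
      rfl
  have howner : ∀ (g : Dart E), D.kind (D.tail (ψ g).1) = .regular → ∀ s,
      ((o ((ψ g).1, s)).1 ∈ F' ↔ g.1 ∈ F) := by
    rintro ⟨e, b⟩ hg s
    have he : e ∉ G.zeroEdges := fun h => (hG.zero_iff (e, b)).1 h hg
    obtain ⟨e', he'⟩ := ε.surjective ⟨e, he⟩
    obtain ⟨b', t, f, h1, h2⟩ := hε e' b
    rw [he'] at h2
    rw [← h2, hofst f.1 s f.2, holine h1, hF, he']
  have hzero : ∀ (g : Dart E), g.1 ∈ G.zeroEdges ↔ D.kind (D.tail (ψ g).1) ≠ .regular :=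
    hG.zero_iff
  have hnd : ∀ g, D.kind (D.tail (ψ g).1) ≠ .disc := fun g => ((hG.range_iff _).1 ⟨g, rfl⟩).1
  have hfalse : ∀ g, D.kind (D.tail (ψ g).1) ≠ .crossing → (ψ g).2 = false := fun g h => by
    by_contra h'
    exact h (((hG.range_iff _).1 ⟨g, rfl⟩).2 (by simpa using h'))
  have hcontZ : ∀ x : DartSide E, D.kind (D.tail (ψ x.1).1) ≠ .regular →
      Quot.mk (G.emb.curveStep G.zeroEdges F) (x.1.flip, x.2) = Quot.mk _ x := by
    intro x hx
    rw [← EmbGraph.mk_continuation _ _ _ x, EmbGraph.continuation, if_pos ((hzero _).2 hx)]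
  have hcornert : ∀ x : Dart E, Quot.mk (G.emb.curveStep G.zeroEdges F) (G.rot x, false) =
      Quot.mk _ (x, true) := fun x => EmbGraph.mk_corner G.emb _ _ (x, true)
  have hmk : ∀ {x x' : Dart E} {s : Bool}, ψ x = ψ x' →
      Quot.mk (G.emb.curveStep G.zeroEdges F) (x, s) = Quot.mk _ (x', s) := by
    intro x x' s h
    rw [hG.injective h]
  -- from the medial curves to the owners
  let Ω : DartSide E → Corner E' := fun x =>
    -- At a crossing the two darts of a portion enclose an angle facing the crossing disc; it is the
    -- case `x.2 ≠ (ψ x.1).2`. The curve there is the side of the transversal ribbon, whose portion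
    -- clockwise of the dart shows its left side. Elsewhere the curve is a side of the portion
    -- itself, with left and right exchanged because the dart of `G` points towards the node and
    -- that of the picture away from it.
    if D.kind (D.tail (ψ x.1).1) = .crossing ∧ x.2 ≠ (ψ x.1).2 then
      o (D.rot.symm (ψ x.1).1, true) else o ((ψ x.1).1, !x.2)
  have hΩcorner : ∀ x : Dart E, Quot.mk (R.boundaryStep F') (Ω (G.rot x, false)) =
      Quot.mk _ (Ω (x, true)) := by
    intro x
    by_cases hx : D.kind (D.tail (ψ x).1) = .crossing ∧ (ψ x).2 = false
    · have h1 : ψ x = ((ψ x).1, false) := Prod.ext rfl hx.2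
      have h2 : ψ (G.rot x) = ((ψ x).1, true) := by
        rw [hG.rot, h1, D.endRot_crossing_false hx.1]
      simp only [Ω, h2, hx.1, hx.2]
      simp
    · have h1 : ψ (G.rot x) = (D.nextEnd (ψ x).1, false) := by
        rw [hG.rot]
        rcases hb : (ψ x).2 with _ | _
        · exact D.endRot_of_ne_crossing fun h => hx ⟨h, hb⟩
        · have : ψ x = ((ψ x).1, true) := Prod.ext rfl hb
          rw [this, D.endRot_true]
      have h2 : Ω (x, true) = o ((ψ x).1, false) := by
        refine if_neg fun h => hx ⟨h.1, ?_⟩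
        simpa using h.2.symm
      have h3 : Ω (G.rot x, false) = o (D.nextEnd (ψ x).1, true) := by
        simp only [Ω, h1]
        simp
      rw [h2, h3]
      have h4 : o ((ψ x).1, false) = o ((ψ x).1.flip, true) := (hoopp ((ψ x).1, false)).symm
      by_cases hd : D.kind (D.tail (ψ x).1.flip) = .disc
      · obtain ⟨c, hc⟩ := (hD.range_iff ((ψ x).1.flip, true)).2 hd
        have h5 : φ (R.link c) = (D.rot (ψ x).1.flip, false) := by
          rw [hD.link, hc]
          rfl
        have h6 : o ((D.rot (ψ x).1.flip).flip, true) = o (D.rot (ψ x).1.flip, false) :=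
          hoopp (D.rot (ψ x).1.flip, false)
        rw [D.nextEnd_disc hd, h4, h6, ← h5, ← hc, ho, ho, R.mk_link]
      · rw [D.nextEnd_of_ne_disc hd, h4]
  have hΩflip : ∀ x : DartSide E, D.kind (D.tail (ψ x.1).1) ≠ .regular →
      Ω (x.1.flip, x.2) = Ω x := by
    have hcr : ∀ x : DartSide E, D.kind (D.tail (ψ x.1).1) = .crossing → (ψ x.1).2 = false →
        Ω (x.1.flip, x.2) = Ω x := by
      rintro ⟨g, s⟩ hk hf
      simp only at hk hf
      have h1 : ψ g = ((ψ g).1, false) := Prod.ext rfl hf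
      have h2 : ψ g.flip = (D.rot (ψ g).1, true) := by
        rw [hG.flip, h1, D.endMate_crossing_false hk]
      have hk' : D.kind (D.tail (D.rot (ψ g).1)) = .crossing := by rw [D.tail_rot, hk]
      cases s
      · simp only [Ω, h2, hk, hk', hf]
        simp
      · simp only [Ω, h2, hk, hk', hf]
        have h3 := hopass' (D.rot.symm (ψ g).1, true)
        have ht : D.tail (D.rot.symm (ψ g).1) = D.tail (ψ g).1 := by
          rw [← D.tail_rot, Equiv.apply_symm_apply]
        rw [D.pass_crossing (by rw [ht, hk])] at h3
        simp only [ht, hk, Equiv.apply_symm_apply] at h3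
        simpa using h3
    rintro ⟨g, s⟩ hr
    rcases hk : D.kind (D.tail (ψ g).1)
    · exact absurd hk (hnd g)
    · exact absurd hk hr
    · have h1 : ψ g = ((ψ g).1, false) := Prod.ext rfl (hfalse g (by rw [hk]; simp))
      have h2 : ψ g.flip = (D.rot (ψ g).1, false) := by
        rw [hG.flip, h1, D.endMate_of_ne_crossing (by rw [hk]; simp)]
      have h3 := hopass' ((ψ g).1, !s) (by simp [hk]) (by simp [hk])
      rw [D.pass_twist (f := ((ψ g).1, !s)) hk] at h3
      simp only [Ω, h2, hk, D.tail_rot]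
      simpa using h3
    · rcases hb : (ψ g).2 with _ | _
      · exact hcr (g, s) hk hb
      · have hfl : ψ g.flip = (D.rot.symm (ψ g).1, false) := by
          have : ψ g = ((ψ g).1, true) := Prod.ext rfl hb
          rw [hG.flip, this]
          simp only [endMate, hk]
        have := hcr (g.flip, s) (by
          rw [hfl]
          change D.kind (D.tail (D.rot.symm (ψ g).1)) = _
          rw [← D.tail_rot, Equiv.apply_symm_apply, hk]) (by rw [hfl])
        simp only [Dart.flip_flip] at this
        exact this.symm
  let toR : Quot (G.emb.curveStep G.zeroEdges F) → Quot (R.boundaryStep F') :=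
    Quot.lift (fun x => Quot.mk _ (Ω x)) (by
      rintro ⟨g, s⟩ _ (rfl | rfl)
      · cases s
        · have := hΩcorner (G.rot.symm g)
          rw [Equiv.apply_symm_apply] at this
          exact this
        · exact (hΩcorner g).symm
      · by_cases hz : g.1 ∈ G.zeroEdges
        · have : EmbGraph.continuation G.zeroEdges F (g, s) = (g.flip, s) := if_pos hz
          rw [this, hΩflip (g, s) ((hzero g).1 hz)]
        · have hk : D.kind (D.tail (ψ g).1) = .regular := by
            by_contra h
            exact hz ((hzero g).2 h)
          have hΩ : ∀ s, Ω (g, s) = o ((ψ g).1, !s) := fun s => if_neg (by simp [hk])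
          by_cases hgF : g.1 ∈ F
          · have h1 : EmbGraph.continuation G.zeroEdges F (g, s) = (g.flip, !s) := by
              simp [EmbGraph.continuation, hz, hgF]
            have h2 : ψ g.flip = (D.rot (ψ g).1, false) := by
              rw [hG.flip]
              exact D.endMate_of_ne_crossing (by rw [hk]; simp)
            have h3 : Ω (g.flip, !s) = (Ω (g, s)).along := by
              have h4 := hopass ((ψ g).1, !s) hk
              rw [D.pass_regular (f := ((ψ g).1, !s)) hk] at h4
              rw [hΩ, ← h4]
              simp only [Ω, h2, D.tail_rot, hk]
              simp
            rw [h1, h3, R.mk_along]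
            rw [hΩ]
            exact (howner g hk _).2 hgF
          · have h1 : EmbGraph.continuation G.zeroEdges F (g, s) = (g, !s) := by
              simp [EmbGraph.continuation, hz, hgF]
            have h3 : Ω (g, !s) = (Ω (g, s)).across := by
              rw [hΩ, hΩ, ← hoswap]
              rfl
            rw [h1, h3, R.mk_across]
            rw [hΩ]
            exact fun h => hgF ((howner g hk _).1 h))
  -- and back
  let Rep : DartSide A → DartSide E → Prop := fun f x => x.2 = (!f.2) ∧
    -- At a crossing the double point on the side of `f` is chosen: left is named `true` in `f` but
    -- `false` in the darts of `G`.
    ψ x.1 = (f.1, if D.kind (D.tail f.1) = .crossing then !f.2 else false)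
  have hrep : ∀ f : DartSide A, D.kind (D.tail f.1) ≠ .disc → ∃ x, Rep f x := by
    intro f hf
    obtain ⟨g, hg⟩ := (hG.range_iff
      (f.1, if D.kind (D.tail f.1) = .crossing then !f.2 else false)).2
      ⟨hf, by intro h; by_contra h'; simp [h'] at h⟩
    exact ⟨(g, !f.2), rfl, hg⟩
  have hlam : ∀ f : DartSide A, ∃ x, (D.kind (D.tail f.1) ≠ .disc → Rep f x) ∧
      (D.kind (D.tail f.1) = .disc → Rep f.opposite x) := by
    intro f
    by_cases hf : D.kind (D.tail f.1) = .disc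
    · obtain ⟨x, hx⟩ := hrep f.opposite (hflip _ hf)
      exact ⟨x, fun h => absurd hf h, fun _ => hx⟩
    · obtain ⟨x, hx⟩ := hrep f hf
      exact ⟨x, fun _ => hx, fun h => absurd h hf⟩
  choose lam hlamn hlamd using hlam
  have hRep : ∀ {f : DartSide A} {x x' : DartSide E}, Rep f x → Rep f x' → x = x' := by
    rintro f x x' ⟨h1, h2⟩ ⟨h3, h4⟩
    exact Prod.ext (hG.injective (h2.trans h4.symm)) (h1.trans h3.symm)
  let Λ : DartSide A → Quot (G.emb.curveStep G.zeroEdges F) := fun f => Quot.mk _ (lam f)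
  have hΛ : ∀ {f : DartSide A} {x : DartSide E}, D.kind (D.tail f.1) ≠ .disc → Rep f x →
      Λ f = Quot.mk _ x := fun hf hx => congrArg _ (hRep (hlamn _ hf) hx)
  have hΛopp0 : ∀ f : DartSide A, D.kind (D.tail f.1) = .disc → Λ f.opposite = Λ f := fun f hf =>
    hΛ (hflip _ hf) (hlamd f hf)
  have hrotend : ∀ {y : Dart A} {x : DartSide E}, Rep (y, false) x →
      x.2 = true ∧ ψ (G.rot x.1) = (D.nextEnd y, false) := by
    rintro y x ⟨h1, h2⟩
    refine ⟨h1, ?_⟩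
    rw [hG.rot, h2]
    by_cases hk : D.kind (D.tail y) = .crossing
    · simp only [hk, if_true]
      exact D.endRot_true y
    · exact D.endRot_of_ne_crossing hk
  have hΛnext : ∀ (y z : Dart A), D.kind (D.tail y) ≠ .disc → D.kind (D.tail z) ≠ .disc →
      D.nextEnd y = z → Λ (y, false) = Λ (z, true) := by
    rintro y z hy hz rfl
    obtain ⟨⟨g, s⟩, hx⟩ := hrep (y, false) hy
    obtain ⟨h1, h2⟩ := hrotend hx
    simp only at h1 h2
    subst h1
    have hz' : Rep (D.nextEnd y, true) (G.rot g, false) := ⟨rfl, by rw [h2]; simp⟩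
    rw [hΛ hy hx, hΛ hz hz', hcornert]
  have hΛopp : ∀ f : DartSide A, Λ f.opposite = Λ f := by
    have key : ∀ y : Dart A, D.kind (D.tail y) ≠ .disc → D.kind (D.tail y.flip) ≠ .disc →
        Λ (y, false) = Λ (y.flip, true) := fun y h1 h2 =>
      hΛnext y _ h1 h2 (D.nextEnd_of_ne_disc h2)
    intro f
    by_cases h1 : D.kind (D.tail f.1) = .disc
    · exact hΛopp0 f h1
    by_cases h2 : D.kind (D.tail f.1.flip) = .disc
    · have := hΛopp0 f.opposite h2
      rw [DartSide.opposite_opposite] at this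
      exact this.symm
    · obtain ⟨y, s⟩ := f
      cases s
      · exact (key y h1 h2).symm
      · have := key y.flip h2 (by rw [Dart.flip_flip]; exact h1)
        rw [Dart.flip_flip] at this
        exact this
  have hΛcorner : ∀ y : Dart A, D.kind (D.tail y) = .disc → Λ (D.rot y, false) = Λ (y, true) := by
    intro y hy
    have h1 : D.kind (D.tail (D.rot y)) = .disc := by rw [D.tail_rot, hy]
    rw [← hΛopp (D.rot y, false), ← hΛopp (y, true)]
    refine (hΛnext y.flip _ (hflip _ hy) (hflip _ h1) ?_).symm
    rw [D.nextEnd_disc (by rw [Dart.flip_flip]; exact hy), Dart.flip_flip]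
  -- Going straight ahead, the left side of `y` passes a double point, the angle facing the disc at
  -- the portion `D.rot y`, and a second double point.
  have hcross : ∀ y : Dart A, D.kind (D.tail y) = .crossing →
      Λ (D.rot (D.rot y), false) = Λ (y, true) := by
    intro y hy
    have hy1 : D.kind (D.tail (D.rot y)) = .crossing := by rw [D.tail_rot, hy]
    have hy2 : D.kind (D.tail (D.rot (D.rot y))) = .crossing := by rw [D.tail_rot, hy1]
    obtain ⟨g, hg⟩ := (hG.range_iff (y, false)).2 ⟨by rw [hy]; simp, by simp⟩
    obtain ⟨g', hg'⟩ := (hG.range_iff (D.rot y, false)).2 ⟨by rw [hy1]; simp, by simp⟩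
    have h1 : ψ g.flip = (D.rot y, true) := by
      rw [hG.flip, hg, D.endMate_crossing_false hy]
    have h2 : ψ g'.flip = (D.rot (D.rot y), true) := by
      rw [hG.flip, hg', D.endMate_crossing_false hy1]
    have h3 : ψ (G.rot g') = ψ g.flip := by
      rw [hG.rot, hg', D.endRot_crossing_false hy1, h1]
    have e1 : Λ (y, true) = Quot.mk _ (g, false) :=
      hΛ (by rw [hy]; simp) ⟨rfl, by rw [hg]; simp⟩
    have e2 : Λ (D.rot (D.rot y), false) = Quot.mk _ (g'.flip, true) :=
      hΛ (by rw [hy2]; simp) ⟨rfl, by rw [h2]; simp [hy2]⟩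
    rw [e1, e2, hcontZ (g', true) (by rw [hg', hy1]; simp), ← hcornert, hmk h3,
      hcontZ (g, false) (by rw [hg, hy]; simp)]
  have hΛpass : ∀ f : DartSide A, f ∉ D.markedSides → Λ (D.pass f) = Λ f := by
    rintro ⟨y, s⟩ hf
    rcases hk : D.kind (D.tail y)
    · exact absurd (Or.inl hk) hf
    · exact absurd (Or.inr hk) hf
    · have hk' : D.kind (D.tail (D.rot y)) = .twist := by rw [D.tail_rot, hk]
      obtain ⟨g, hg⟩ := (hG.range_iff (y, false)).2 ⟨by rw [hk]; simp, by simp⟩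
      have h1 : ψ g.flip = (D.rot y, false) := by
        rw [hG.flip, hg, D.endMate_of_ne_crossing (by rw [hk]; simp)]
      rw [D.pass_twist hk]
      have e1 : Λ (y, s) = Quot.mk _ (g, !s) :=
        hΛ (by rw [hk]; simp) ⟨rfl, by rw [hg]; simp [hk]⟩
      have e2 : Λ (D.rot y, s) = Quot.mk _ (g.flip, !s) :=
        hΛ (by rw [hk']; simp) ⟨rfl, by rw [h1]; simp [hk']⟩
      rw [e1, e2]
      exact hcontZ (g, !s) (by rw [hg, hk]; simp)
    · rw [D.pass_crossing hk]
      cases s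
      · have := hcross (D.rot (D.rot y)) (by rw [D.tail_rot, D.tail_rot, hk])
        rw [(D.crossing_deg y hk).2] at this
        exact this.symm
      · exact hcross y hk
  have hΛo : ∀ f, Λ (φ (o f)) = Λ f := by
    intro f
    refine (congrArg (Quot.lift Λ ?_) (homk f)).symm
    rintro f g (rfl | ⟨hf, rfl⟩)
    · exact (hΛopp f).symm
    · exact (hΛpass f hf).symm
  have hΛregular : ∀ f : DartSide A, D.kind (D.tail f.1) = .regular →
      ((o f).1 ∈ F' → Λ (D.pass f) = Λ f) ∧ ((o f).1 ∉ F' → Λ f.swap = Λ f) := by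
    rintro ⟨y, s⟩ hk
    simp only at hk
    obtain ⟨g, hg⟩ := (hG.range_iff (y, false)).2 ⟨by rw [hk]; simp, by simp⟩
    have hgk : D.kind (D.tail (ψ g).1) = .regular := by rw [hg, hk]
    have hz : g.1 ∉ G.zeroEdges := fun h => (hzero g).1 h hgk
    have how := howner g hgk s
    rw [hg] at how
    have e1 : ∀ s, Λ (y, s) = Quot.mk _ (g, !s) := fun s =>
      hΛ (by rw [hk]; simp) ⟨rfl, by rw [hg]; simp [hk]⟩
    constructor
    · intro hF'
      have hgF : g.1 ∈ F := how.1 hF'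
      have hk' : D.kind (D.tail (D.rot y)) = .regular := by rw [D.tail_rot, hk]
      have h1 : ψ g.flip = (D.rot y, false) := by
        rw [hG.flip, hg, D.endMate_of_ne_crossing (by rw [hk]; simp)]
      have e2 : Λ (D.rot y, !s) = Quot.mk _ (g.flip, !!s) :=
        hΛ (by rw [hk']; simp) ⟨rfl, by rw [h1]; simp [hk']⟩
      rw [D.pass_regular hk]
      refine e2.trans (Eq.trans ?_ (e1 s).symm)
      rw [← EmbGraph.mk_continuation _ _ _ (g, !s)]
      simp [EmbGraph.continuation, hz, hgF]
    · intro hF'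
      have hgF : g.1 ∉ F := fun h => hF' (how.2 h)
      refine (e1 (!s)).trans (Eq.trans ?_ (e1 s).symm)
      rw [← EmbGraph.mk_continuation _ _ _ (g, !s)]
      simp [EmbGraph.continuation, hz, hgF]
  let toG : Quot (R.boundaryStep F') → Quot (G.emb.curveStep G.zeroEdges F) :=
    Quot.lift (fun c => Λ (φ c)) (by
      rintro c _ (rfl | ⟨hc, rfl⟩ | ⟨hc, rfl⟩)
      · rw [hD.link]
        have hd := hdisc c
        generalize φ c = f at hd
        obtain ⟨y, s⟩ := f
        cases s
        · have := hΛcorner (D.rot.symm y) (by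
            rw [← D.tail_rot, Equiv.apply_symm_apply]; exact hd)
          rw [Equiv.apply_symm_apply] at this
          exact this
        · exact (hΛcorner y hd).symm
      · obtain ⟨f, hf, rfl⟩ := hoex c
        rw [← hopass f hf, hΛo, hΛo, (hΛregular f hf).1 hc]
      · obtain ⟨f, hf, rfl⟩ := hoex c
        rw [← hoswap f, hΛo, hΛo, (hΛregular f hf).2 hc])
  have hcard : Nat.card (Quot (R.boundaryStep F')) =
      Nat.card (Quot (G.emb.curveStep G.zeroEdges F)) := by
    refine Nat.card_congr ⟨toG, toR, fun q => ?_, fun q => ?_⟩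
    · induction q using Quot.ind with
      | mk c =>
        obtain ⟨h1, h2⟩ := hlamd (φ c) (hdisc c)
        have h3 : Ω (lam (φ c)) = c := by
          have h4 : ((ψ (lam (φ c)).1).1, !(lam (φ c)).2) = (φ c).opposite := by
            rw [h1, h2]
            simp
          refine Eq.trans (if_neg ?_) ((congrArg o h4).trans ((hoopp _).trans (ho c)))
          rw [h1, h2]
          rintro ⟨h5, h6⟩
          simp only at h5
          simp [h5] at h6
        exact congrArg _ h3
    · induction q using Quot.ind with
      | mk x =>
        obtain ⟨g, s⟩ := x
        change Λ (φ (Ω (g, s))) = _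
        by_cases hx : D.kind (D.tail (ψ g).1) = .crossing ∧ s ≠ (ψ g).2
        · have h1 : Ω (g, s) = o (D.rot.symm (ψ g).1, true) := if_pos hx
          have hk : D.kind (D.tail (D.rot.symm (ψ g).1)) = .crossing := by
            rw [← D.tail_rot, Equiv.apply_symm_apply, hx.1]
          obtain ⟨g₀, hg₀⟩ := (hG.range_iff (D.rot.symm (ψ g).1, false)).2
            ⟨by rw [hk]; simp, by simp⟩
          have h2 : ψ g₀.flip = ((ψ g).1, true) := by
            rw [hG.flip, hg₀, D.endMate_crossing_false hk, Equiv.apply_symm_apply]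
          have h3 : Λ (D.rot.symm (ψ g).1, true) = Quot.mk _ (g₀, false) :=
            hΛ (by rw [hk]; simp) ⟨rfl, by rw [hg₀]; simp⟩
          rw [h1, hΛo, h3, ← hcontZ (g₀, false) (by rw [hg₀, hk]; simp)]
          rcases hb : (ψ g).2 with _ | _
          · have hs : s = true := by simpa [hb] using hx.2
            have hg : ψ g = ((ψ g).1, false) := Prod.ext rfl hb
            rw [hs, ← hcornert]
            refine hmk ?_
            rw [h2, hG.rot, hg, D.endRot_crossing_false hx.1]
          · have hs : s = false := by simpa [hb] using hx.2
            rw [hs]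
            exact hmk (h2.trans (Prod.ext rfl hb.symm))
        · have h1 : Ω (g, s) = o ((ψ g).1, !s) := if_neg hx
          rw [h1, hΛo]
          refine hΛ (hnd g) ⟨by simp, Prod.ext rfl ?_⟩
          by_cases hk : D.kind (D.tail (ψ g).1) = .crossing
          · have : s = (ψ g).2 := by
              by_contra h
              exact hx ⟨hk, h⟩
            simp [hk, this]
          · simp [hk, hfalse g hk]
  have hb : R.boundary F' = Nat.card (Quot (R.boundaryStep F')) + R.isolated := rfl
  rw [hb, hcard, hD.isolated, hG.bare]

end RibbonPicture

/-! ### Comparison of the two polynomials. -/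

theorem RibbonGraph.boundary_eq {V E E' : Type*} [Fintype V] [Fintype E] [DecidableEq E]
    [DecidableEq E'] {G : RelPlaneGraph V E} {R : RibbonGraph E'}
    {ε : E' ≃ {e : E // e ∉ G.zeroEdges}} (hGR : G.IsOfProjection R ε ∨ R.ArisesFrom G ε)
    {F : Finset E} {F' : Finset E'} (hF : ∀ e, e ∈ F' ↔ (ε e).1 ∈ F) :
    R.boundary F' = Nat.card (Quot (G.emb.curveStep G.zeroEdges F)) + G.emb.bare := by
  rcases hGR with ⟨m, n, D, φ, ψ, hD, hG, hε⟩ | h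
  · exact RibbonPicture.boundary_of_isProjection hD hG hε hF
  · exact RibbonGraph.boundary_of_arisesFrom h hF

theorem RelPlaneGraph.contracted_spec {V E : Type*} [Fintype V] [DecidableEq V] [Fintype E]
    [DecidableEq E] (G : RelPlaneGraph V E) {F : Finset E} (hF : Disjoint F G.zeroEdges)
    {l : List E} (hl : l.Nodup) (hlF : l.toFinset = F) :
    (G.contracted F l).components (G.contracted F l).edges =
        G.emb.components (F ∪ G.zeroEdges) ∧
      (G.contracted F l).verts.card = G.emb.components F ∧
      Nat.card (Quot (G.emb.curveStep G.zeroEdges F)) + G.emb.bare + G.emb.verts.card =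
        (G.contracted F l).medialCircles (G.contracted F l).edges + F.card +
          (G.contracted F l).verts.card := by
  subst hlF
  obtain ⟨h1, h2, h3, h4, h5⟩ := EmbGraph.contractList_spec (H := G.zeroEdges) l
    (G.emb.restrict (l.toFinset ∪ G.zeroEdges)) (fun _ => Finset.mem_univ _) hl rfl hF
    (G.exact_emb.restrict (Finset.subset_univ _))
  change (G.contracted l.toFinset l).edges = _ at h1
  change (G.contracted l.toFinset l).components G.zeroEdges = _ at h2
  change (G.contracted l.toFinset l).bare = G.emb.bare at h4
  change Nat.card (Quot (G.emb.curveStep G.zeroEdges l.toFinset)) + G.emb.verts.card =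
    Nat.card (Quot ((G.contracted l.toFinset l).curveStep G.zeroEdges ∅)) + l.length +
      (G.contracted l.toFinset l).verts.card at h5
  rw [EmbGraph.curveStep_empty] at h5
  refine ⟨by rw [h1]; exact h2, h3, ?_⟩
  have h6 : (G.contracted l.toFinset l).medialCircles G.zeroEdges =
    Nat.card (Quot ((G.contracted l.toFinset l).medialStep G.zeroEdges)) +
      (G.contracted l.toFinset l).bare := rfl
  rw [h1, h6, h4, List.toFinset_card_of_nodup hl]
  omega

/-- Collects the exponents of the roots p = √X and q = √Y, with d = pq and w = p/q. -/
theorem zpow_sq_mul {K : Type*} [CommGroup K] (p q : K) (a b c d : ℤ) :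
    (p ^ 2) ^ a * (q ^ 2) ^ b * ((p * q) ^ c * (p / q) ^ d) =
      p ^ (2 * a + c + d) * q ^ (2 * b + c - d) := by
  have h : ∀ g : K, (g ^ 2 : K) = g ^ (2 : ℤ) := fun g => (zpow_natCast g 2).symm
  rw [h, h, ← zpow_mul, ← zpow_mul, mul_zpow, div_zpow, zpow_add, zpow_add, zpow_sub, zpow_add,
    div_eq_mul_inv]
  ac_rfl

theorem mainTheorem1 {V E E' K : Type*} [Fintype V] [DecidableEq V] [Fintype E] [DecidableEq E]
    [Fintype E'] [DecidableEq E'] [CommRing K]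
    (G : RelPlaneGraph V E) (R : RibbonGraph E') (ε : E' ≃ {e : E // e ∉ G.zeroEdges})
    (hGR : G.IsOfProjection R ε ∨ R.ArisesFrom G ε)
    (ord : Finset E → List E) (hord : ∀ F, (ord F).Nodup ∧ (ord F).toFinset = F)
    (x y : E → K) (X Y rX rY : Kˣ) (hX : rX ^ 2 = X) (hY : rY ^ 2 = Y)
    (twoα twoβ : ℤ) (hβ : twoβ = -((R.vertices : ℤ) - (Fintype.card V : ℤ)))
    (hα : twoα = 2 * ((G.emb.components Finset.univ : ℤ) - (R.components Finset.univ : ℤ)) - twoβ) :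
    ((rX ^ twoα * rY ^ twoβ : Kˣ) : K) * G.tutte ord x y (rX / rY) (rX * rY) X Y =
      R.bollobasRiordan (fun e => x (ε e).1) (fun e => y (ε e).1) X Y (1 / (rX * rY)) := by
  subst hX hY
  let ι : E' ↪ E := ε.toEmbedding.trans (Function.Embedding.subtype _)
  have hι : ∀ e, ι e = (ε e).1 := fun _ => rfl
  have hιH : ∀ e, ι e ∉ G.zeroEdges := fun e => (ε e).2
  have hιsurj : ∀ e, e ∉ G.zeroEdges → ∃ e', ι e' = e := fun e he =>
    ⟨ε.symm ⟨e, he⟩, by rw [hι, Equiv.apply_symm_apply]⟩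
  unfold RelPlaneGraph.tutte RibbonGraph.bollobasRiordan
  rw [Finset.mul_sum]
  symm
  refine Finset.sum_bij (fun F _ => F.map ι) ?_ ?_ ?_ ?_
  · intro F _
    rw [Finset.mem_powerset]
    intro e he
    obtain ⟨e', -, rfl⟩ := Finset.mem_map.1 he
    exact Finset.mem_compl.2 (hιH e')
  · intro F _ F' _ h
    exact Finset.map_injective ι h
  · intro F hF
    refine ⟨Finset.univ.filter fun e => ι e ∈ F, Finset.mem_univ _, ?_⟩
    ext e
    simp only [Finset.mem_map, Finset.mem_filter, Finset.mem_univ, true_and]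
    constructor
    · rintro ⟨e', h, rfl⟩
      exact h
    · intro he
      obtain ⟨e', rfl⟩ := hιsurj e (Finset.mem_compl.1 (Finset.mem_powerset.1 hF he))
      exact ⟨e', he, rfl⟩
  · intro F' _
    have hdisj : Disjoint (F'.map ι) G.zeroEdges := by
      rw [Finset.disjoint_left]
      intro e he
      obtain ⟨e', -, rfl⟩ := Finset.mem_map.1 he
      exact hιH e'
    have hbd := RibbonGraph.boundary_eq hGR (F := F'.map ι) (F' := F')
      (fun e => by rw [← hι, Finset.mem_map' ι])
    obtain ⟨h1, h2, h3⟩ := G.contracted_spec hdisj (hord _).1 (hord (F'.map ι)).2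
    rw [← hbd, Finset.card_map] at h3
    have hcompl : (F'.map ι ∪ G.zeroEdges)ᶜ = F'ᶜ.map ι := by
      ext e
      simp only [Finset.mem_compl, Finset.mem_union, not_or]
      constructor
      · rintro ⟨h4, h5⟩
        obtain ⟨e', rfl⟩ := hιsurj e h5
        rw [Finset.mem_map'] at h4 ⊢
        exact Finset.mem_compl.2 h4
      · intro h
        obtain ⟨e', he', rfl⟩ := Finset.mem_map.1 h
        exact ⟨by rw [Finset.mem_map']; exact Finset.mem_compl.1 he', hιH e'⟩
    rw [hcompl, Finset.prod_map, Finset.prod_map, mul_left_comm]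
    congr 1
    rw [← Units.val_mul]
    congr 1
    -- The trivial factor brings the power of Z into the shape required by `zpow_sq_mul`.
    have hR : ∀ n : ℤ, (1 / (rX * rY)) ^ n = (rX * rY) ^ (-n) * (rX / rY) ^ (0 : ℤ) := by
      intro n
      rw [one_div, inv_zpow', zpow_zero, mul_one]
    rw [hR, zpow_sq_mul, zpow_sq_mul, mul_mul_mul_comm, ← zpow_add, ← zpow_add]
    have hV : G.emb.verts.card = Fintype.card V := rfl
    unfold RibbonGraph.nullity EmbGraph.nullity
    rw [hα, hβ, h1, h2, Finset.card_map]
    rw [h2] at h3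
    -- One linear identity for each root; both follow from `h3`, that is bc(F) + v(G) = δ(H_F) + |F|
    -- + k(F).
    congr 2 <;> omega
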